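/- Let $\mathcal L$ be a first-order language and let $\mathfrak C$ be a monster model of a complete $\mathcal L$-theory $T$: for some cardinal $\bar\kappa$, $\mathfrak C$ is $\bar\kappa$-saturated and strongly $\bar\kappa$-homogeneous (every elementary map from a subset of $\mathfrak C$ of cardinality $<\bar\kappa$ into $\mathfrak C$ extends to an automorphism). Call a set small if its cardinality is $<\bar\kappa$, and write $|T|=\max(\aleph_0,|\mathcal L|)$. Let $\perp$ be a symmetric independence relation on $\mathfrak C$, that is, a ternary relation $A\perp_B C$ on small subsets of $\mathfrak C$ such that, for all small $A,B,C,D$: (Invariance) $A\perp_B C\Rightarrow\sigma(A)\perp_{\sigma(B)}\sigma(C)$ for every $\sigma\in\mathrm{Aut}(\mathfrak C)$; (Normality) $A\perp_C B\Rightarrow A\cup C\perp_C B$; (Symmetry) $A\perp_B C\Rightarrow C\perp_B A$; (Transitivity) if $B\subseteq C\subseteq D$, then $A\perp_B D$ iff $A\perp_B C$ and $A\perp_C D$; (Finite character) $A\perp_B C$ iff $A_0\perp_B C$ for all finite $A_0\subseteq A$; (Extension) there is $A'\equiv_B A$ with $A'\perp_B C$; (Local character) there is a small cardinal $\lambda$,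 depending only on $\perp$, such that for all small $A,C$ there is $C_0\subseteq C$ with $|C_0|<\lambda+|A|^+$ and $A\perp_{C_0}C$. Let $\kappa_0$ be the least regular cardinal such that for every finite $A$ and small $B$ there is $B_0\subseteq B$ with $|B_0|<\kappa_0$ and $A\perp_{B_0}B$. For a complete type $q$ over a small set, $q\perp_B C$ means that some realization $c\in\mathfrak C$ of $q$ satisfies $c\perp_B C$. Fix a small cardinal $\kappa>\max(\kappa_0,|T|)$. Let $M\preceq\mathfrak C$ be small and $P(M)\subseteq M$, and put $P(A)=A\cap P(M)$ for $A\subseteq M$. Assume that $(M,P(M))$ is a ($\perp$-)lovely pair, that is, for every $A\subseteq M$ with $|A|<\kappa$ and every complete $\mathcal L$-$1$-type $q\in S_1(A)$: (Density) if $q\perp_{P(A)}A$, then $q$ is realized in $P(M)$; (Extension) there is $b\in M$ realizing $q$ with $b\perp_A P(M)$. Let $\bar a\subseteq M$ be a set (or tuple) that is $P$-independent, i.e. $\bar a\perp_{P(\bar a)}P(M)$. Let $\mathrm{acl}^1,\mathrm{dcl}^1$ denote the algebraic and definable closure in $M^{\mathrm{eq}}$ with respect to $\mathcal L$, and $\mathrm{acl}^2,\mathrm{dcl}^2$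 the algebraic and definable closure in $(M,P(M))^{\mathrm{eq}}\supseteq M^{\mathrm{eq}}$ with respect to $\mathcal L^2=\mathcal L\cup\{P\}$. Then $$\mathrm{acl}^2(\bar a)\cap M^{\mathrm{eq}}=\mathrm{acl}^1(\bar a)\cap M^{\mathrm{eq}}\quad\text{and}\quad\mathrm{dcl}^2(\bar a)\cap M^{\mathrm{eq}}=\mathrm{dcl}^1(\bar a)\cap M^{\mathrm{eq}}.$$ -/

import Mathlib

open FirstOrder Cardinal

universe u v w

namespace LovelyPairs

/-! ### Types over sets, monster models -/

section Monster

variable (L : FirstOrder.Language.{u, v}) {C : Type w} [L.Structure C]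

/-- `S₁(A)`: the complete `1`-types over the set of parameters `A ⊆ C`. -/
abbrev TypeOver (A : Set C) : Type _ :=
  ((L[[A]]).completeTheory C).CompleteType (Fin 1)

variable {L} in
/-- The element `c` of `C` realizes the type `q` over `A`, i.e. `q = tp(c / A)`. -/
def Realizes [Nonempty C] {A : Set C} (q : TypeOver L A) (c : C) : Prop :=
  ((L[[A]]).completeTheory C).typeOf (fun _ : Fin 1 => c) = q

/-- The tuples `f` and `g` (indexed by an arbitrary type) have the same type over `B`. -/
def SameTypeOver (B : Set C) {ι : Type*} (f g : ι → C) : Prop :=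
  ∀ φ : (L[[B]]).Formula ι, φ.Realize f ↔ φ.Realize g

variable (C) in
/-- `C` is a monster model (of its own complete theory) of monstrosity `kbar`: it is
`kbar`-saturated and strongly `kbar`-homogeneous. A set is *small* if its cardinality is
less than `kbar`. -/
structure IsMonster [Nonempty C] (kbar : Cardinal.{w}) : Prop where
  saturated : ∀ A : Set C, #A < kbar → ∀ q : TypeOver L A, ∃ c : C, Realizes q c
  homogeneous : ∀ A : Set C, #A < kbar → ∀ f : A → C,
    SameTypeOver L ∅ f (fun a : A => (a : C)) → ∃ σ : C ≃[L] C, ∀ a : A, σ a = f a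

/-- A symmetric independence relation on the monster model `C` of monstrosity `kbar`;
`Ind A B D` reads "`A` is independent from `D` over `B`". Only the restriction of `Ind` to
small sets matters. -/
structure IsIndependenceRelation (kbar : Cardinal.{w})
    (Ind : Set C → Set C → Set C → Prop) : Prop where
  invariance : ∀ A B D : Set C, #A < kbar → #B < kbar → #D < kbar →
    ∀ σ : C ≃[L] C, Ind A B D → Ind (σ '' A) (σ '' B) (σ '' D)
  normality : ∀ A B D : Set C, #A < kbar → #B < kbar → #D < kbar →
    Ind A D B → Ind (A ∪ D) D B
  symmetry : ∀ A B D : Set C, #A < kbar → #B < kbar → #D < kbar →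
    Ind A B D → Ind D B A
  transitivity : ∀ A B D E : Set C, #A < kbar → #B < kbar → #D < kbar → #E < kbar →
    B ⊆ D → D ⊆ E → (Ind A B E ↔ Ind A B D ∧ Ind A D E)
  finite_character : ∀ A B D : Set C, #A < kbar → #B < kbar → #D < kbar →
    (Ind A B D ↔ ∀ A₀ ⊆ A, A₀.Finite → Ind A₀ B D)
  extension : ∀ A B D : Set C, #A < kbar → #B < kbar → #D < kbar →
    ∃ f : A → C, SameTypeOver L B f (fun a : A => (a : C)) ∧ Ind (Set.range f) B D
  local_character : ∃ k < kbar, ∀ A D : Set C, #A < kbar → #D < kbar →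
    ∃ D₀ ⊆ D, #D₀ < k + Order.succ #A ∧ Ind A D₀ D

/-- `κ₀`: the least regular cardinal `k` such that for every finite `A` and every small `B`
there is `B₀ ⊆ B` of cardinality `< k` with `A` independent from `B` over `B₀`. -/
noncomputable def kappaZero (kbar : Cardinal.{w}) (Ind : Set C → Set C → Set C → Prop) :
    Cardinal.{w} :=
  sInf {k | k.IsRegular ∧ ∀ A B : Set C, A.Finite → #B < kbar →
    ∃ B₀ ⊆ B, #B₀ < k ∧ Ind A B₀ B}

variable {L} in
/-- The type `q` over `A` is independent from `D` over `B`: some realization of `q` is. -/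
def TypeInd [Nonempty C] (Ind : Set C → Set C → Set C → Prop)
    {A : Set C} (q : TypeOver L A) (B D : Set C) : Prop :=
  ∃ c : C, Realizes q c ∧ Ind {c} B D

variable {L} in
/-- The subset of `C` with the same elements as the subset `A` of the submodel `M`. -/
abbrev up {M : L.ElementarySubstructure C} (A : Set M) : Set C := Subtype.val '' A

variable {L} in
/-- `(M, P)` is a (`kappa`-)lovely pair, with respect to `Ind`, for the theory of `C`; here `M` is
an elementary submodel of `C`, `P = P(M)`, and *very small* means of cardinality `< kappa`. -/
structure IsLovelyPair [Nonempty C] (kbar : Cardinal.{w}) (Ind : Set C → Set C → Set C → Prop)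
    (kappa : Cardinal.{w}) (M : L.ElementarySubstructure C) (P : Set M) : Prop where
  small : #M < kbar
  density : ∀ A : Set M, #A < kappa → ∀ q : TypeOver L (up A),
    TypeInd Ind q (up (A ∩ P)) (up A) → ∃ b ∈ P, Realizes q (b : C)
  extension : ∀ A : Set M, #A < kappa → ∀ q : TypeOver L (up A),
    ∃ b : M, Realizes q (b : C) ∧ Ind {(b : C)} (up A) (up P)

variable {L} in
/-- The subset `A` of `M` is `P`-independent: `A` is independent from `P(M)` over
`P(A) = A ∩ P(M)`. -/
def PIndependent (Ind : Set C → Set C → Set C → Prop) {M : L.ElementarySubstructure C}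
    (P : Set M) (A : Set M) : Prop :=
  Ind (up A) (up (A ∩ P)) (up P)

end Monster

/-! ### Imaginaries -/

section Imaginaries

variable (L : FirstOrder.Language.{u, v}) (M : Type w) [L.Structure M]

/-- A sort of `M^eq`: an equivalence relation on some `M^n` which is definable without
parameters. -/
structure EqSort where
  arity : ℕ
  rel : Setoid (Fin arity → M)
  definable : (∅ : Set M).Definable L
    {v : Fin arity ⊕ Fin arity → M | rel (fun i => v (Sum.inl i)) (fun i => v (Sum.inr i))}

/-- The elements of `M^eq`: a sort together with an equivalence class. -/
abbrev Meq : Type w := Σ S : EqSort L M, Quotient S.rel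

variable {L M}

/-- A subset `D` of the sort `S` of `M^eq` is definable in `M^eq` over `A ⊆ M` iff the set of
representatives of its elements is definable in `M` over `A`. -/
def EqSort.DefinableOver (S : EqSort L M) (A : Set M) (D : Set (Quotient S.rel)) : Prop :=
  A.Definable L {x : Fin S.arity → M | Quotient.mk S.rel x ∈ D}

variable (L)

/-- The algebraic closure of `A ⊆ M` in `M^eq`: the imaginaries lying in some finite set
definable over `A`. -/
def aclEq (A : Set M) : Set (Meq L M) :=
  {e | ∃ D : Set (Quotient e.1.rel), D.Finite ∧ e.2 ∈ D ∧ e.1.DefinableOver A D}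

/-- The definable closure of `A ⊆ M` in `M^eq`: the imaginaries `e` such that `{e}` is
definable over `A`. -/
def dclEq (A : Set M) : Set (Meq L M) :=
  {e | e.1.DefinableOver A {e.2}}

end Imaginaries

/-! ### The language `L²` -/

section Pairs

/-- The relation symbols of the language with a single unary predicate `P`. -/
inductive PredRel : ℕ → Type
  | P : PredRel 1

/-- The language with a single unary predicate `P`. -/
def predLang : FirstOrder.Language := ⟨fun _ => Empty, PredRel⟩

/-- The language `L² = L ∪ {P}`. -/
abbrev L2 (L : FirstOrder.Language.{u, v}) : Language := L.sum predLang

variable (L : FirstOrder.Language.{u, v}) {M : Type w} [L.Structure M]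

/-- The interpretation of the predicate `P` by the subset `P` of `M`. -/
@[reducible] def predStructure (P : Set M) : predLang.Structure M where
  funMap := fun f => nomatch f
  RelMap := fun r x => match r with
    | PredRel.P => x 0 ∈ P

/-- The expansion `(M, P)` of the `L`-structure `M` to an `L²`-structure. -/
@[reducible] def pairStructure (P : Set M) : (L2 L).Structure M :=
  letI := predStructure P
  FirstOrder.Language.sumStructure L predLang M

/-- The elements of `(M, P)^eq`. -/
abbrev PairEq (P : Set M) : Type w :=
  letI := pairStructure L P
  Meq (L2 L) M

/-- The algebraic closure of `A ⊆ M` in `(M, P)^eq`. -/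
def acl2 (P A : Set M) : Set (PairEq L P) :=
  letI := pairStructure L P
  aclEq (L2 L) A

/-- The definable closure of `A ⊆ M` in `(M, P)^eq`. -/
def dcl2 (P A : Set M) : Set (PairEq L P) :=
  letI := pairStructure L P
  dclEq (L2 L) A

variable {L} in
/-- The inclusion of `M^eq` in `(M, P)^eq`: an equivalence relation which is `L`-definable without
parameters is `L²`-definable without parameters. -/
def inclEq (P : Set M) (e : Meq L M) : PairEq L P :=
  letI := predStructure P
  letI := pairStructure L P
  haveI : (FirstOrder.Language.LHom.sumInl : L →ᴸ L2 L).IsExpansionOn M :=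
    FirstOrder.Language.LHom.sumInl_isExpansionOn M
  ⟨⟨e.1.arity, e.1.rel, e.1.definable.map_expansion FirstOrder.Language.LHom.sumInl⟩, e.2⟩

variable {L} in
theorem inclEq_injective (P : Set M) : Function.Injective (inclEq (L := L) P) := by
  rintro ⟨⟨n, r, h⟩, e⟩ ⟨⟨n', r', h'⟩, e'⟩ H
  simp only [inclEq, Sigma.mk.injEq, EqSort.mk.injEq] at H
  obtain ⟨⟨rfl, hr⟩, he⟩ := H
  obtain rfl := eq_of_heq hr
  obtain rfl := eq_of_heq he
  rfl

end Pairs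

end LovelyPairs

/-!
The inclusions from right to left hold because an `L`-definable set is `L²`-definable. For the
converse, let the imaginary `e = [c]` lie in a finite set `D` which is definable over `A` in the
language of pairs. Both equalities follow once `e` is known to lie in an `L`-definable set over `A`
which is no larger than `D` (`LovelyCalculus.exists_definableOver_encard_le`).

Only finitely many parameters of `A` are used, and by local character these lie in a very small
`P`-independent subset `X` of `A`. If every `L`-formula over `X` in the type of `c` had more than
`n = |D|` classes of realizations, then by compactness (`IsMonster.exists_conjugates`) the tuple `c`
would have `n + 1` conjugates over `X` in the monster model, pairwise inequivalent. Enlarge `X` and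
`c` to a very small `P`-independent set `B`, and take `n + 1` copies of `B` which contain these
conjugates. By the extension axiom, their union can be moved over `X` so as to be independent over
`X` from representatives of the elements of `D`. One of the copies still contains a
conjugate of `c` whose class is not in `D`. The density and extension properties of the lovely pair,
for sets instead of elements, realize this copy by a `P`-independent subset of `M`, over `X` and the
representatives (`LovelyCalculus.exists_freeMap`). The same lemma, without the
representatives, shows that the partial elementary maps between very small `P`-independent subsets
of `M` form a back-and-forth system, so that they preserve the formulas of the language of pairs
(`realize_pair_iff`). Hence the class of the new conjugate does lie in `D`, a
contradiction.

No condition on the predicate has to be imposed on these maps: if `X` is independent from `P` over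
`Q ⊆ X ∩ P`, then density shows that `x ∈ X` lies in `P` if and only if `x` is independent
from itself over `Q` (`LovelyCalculus.mem_iff`), and the latter is invariant under automorphisms.
Types over small sets are handled throughout as orbits of automorphisms of the monster model.
-/

namespace LovelyPairs

open FirstOrder.Language Set

/-! ### Partial elementary maps into a monster model -/

section ModelTheory

variable {L : FirstOrder.Language.{u, v}}

/-- The families `g` in `N` and `h` in `N'` satisfy the same formulas without parameters: the
correspondence `g i ↦ h i` is a partial elementary map. -/
def SameTy (L : FirstOrder.Language.{u, v}) {ι N N' : Type*} [L.Structure N] [L.Structure N']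
    (g : ι → N) (h : ι → N') : Prop :=
  ∀ φ : L.Formula ι, φ.Realize g ↔ φ.Realize h

namespace SameTy

variable {ι κ N N' N'' : Type*} [L.Structure N] [L.Structure N'] [L.Structure N'']
  {g : ι → N} {h : ι → N'} {k : ι → N''}

theorem symm (H : SameTy L g h) : SameTy L h g := fun φ => (H φ).symm

theorem trans (H : SameTy L g h) (H' : SameTy L h k) : SameTy L g k :=
  fun φ => (H φ).trans (H' φ)

theorem comp (H : SameTy L g h) (r : κ → ι) : SameTy L (g ∘ r) (h ∘ r) := fun φ => by
  simpa only [Formula.realize_relabel] using H (φ.relabel r)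

theorem eq_iff (H : SameTy L g h) (i j : ι) : g i = g j ↔ h i = h j := by
  simpa [Formula.realize_equal] using H (Term.equal (Term.var i) (Term.var j))

end SameTy

theorem sameTy_equiv {ι N N' : Type*} [L.Structure N] [L.Structure N'] (σ : N ≃[L] N')
    (g : ι → N) : SameTy L (σ ∘ g) g := fun φ => by
  exact StrongHomClass.realize_formula σ φ (v := g)

theorem sameTy_elementarySubstructure {ι C : Type*} [L.Structure C]
    (M : L.ElementarySubstructure C) (g : ι → M) : SameTy L (fun i => (g i : C)) g :=
  fun φ => M.subtype.map_formula φ g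

/-- The type of a family is determined by the types of its finite subfamilies. -/
theorem sameTy_of_finite {ι N : Type*} [L.Structure N] {g h : ι → N}
    (H : ∀ s : Finset ι, SameTy L (fun i : s => g i) (fun i : s => h i)) : SameTy L g h := by
  classical
  intro φ
  have e : ∀ f : ι → N,
      (φ.restrictFreeVar id).Realize (fun i : φ.freeVarFinset => f i) default ↔ φ.Realize f :=
    fun f => BoundedFormula.realize_restrictFreeVar _ (by simp)
  rw [← e, ← e]
  exact H φ.freeVarFinset (φ.restrictFreeVar id)

theorem sameTypeOver_iff {C : Type w} [L.Structure C] {B : Set C} {ι : Type*} {f g : ι → C} :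
    SameTypeOver L B f g ↔
      SameTy L (Sum.elim (Subtype.val : B → C) f) (Sum.elim (Subtype.val : B → C) g) := by
  have e : ∀ (φ : (L[[B]]).Formula ι) (f : ι → C),
      Formula.Realize (BoundedFormula.constantsVarsEquiv φ)
        (Sum.elim (Subtype.val : B → C) f) ↔ φ.Realize f := fun φ f =>
    BoundedFormula.realize_constantsVarsEquiv (φ := φ) (v := f) (xs := default)
  constructor
  · intro H φ
    have := H (BoundedFormula.constantsVarsEquiv.symm φ)
    rw [← e, ← e, Equiv.apply_symm_apply] at this
    exact this
  · intro H φ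
    rw [← e, ← e]
    exact H _

theorem sameTypeOver_empty {C : Type w} [L.Structure C] {ι : Type*} {f g : ι → C}
    (H : SameTy L f g) : SameTypeOver L ∅ f g := by
  rw [sameTypeOver_iff]
  have hr : ∀ f : ι → C, Sum.elim (Subtype.val : (∅ : Set C) → C) f =
      f ∘ (Sum.elim (fun x => absurd x.2 (notMem_empty _)) id : (∅ : Set C) ⊕ ι → ι) := by
    intro f
    funext x
    rcases x with x | x
    · exact absurd x.2 (notMem_empty _)
    · rfl
  rw [hr f, hr g]
  exact H.comp _

section Monster

variable {C : Type w} [L.Structure C] [Nonempty C] {kbar : Cardinal.{w}}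

/-- A correspondence of small families with the same type extends to an automorphism. -/
theorem IsMonster.exists_equiv (hC : IsMonster L C kbar) {ι : Type*} {f g : ι → C}
    (hs : #(range g) < kbar) (H : SameTy L f g) : ∃ σ : C ≃[L] C, ∀ i, σ (g i) = f i := by
  classical
  choose r hr using fun a : range g => a.2
  obtain ⟨σ, hσ⟩ := hC.homogeneous (range g) hs (f ∘ r) (sameTypeOver_empty (by
    have : (fun a : range g => (a : C)) = g ∘ r := funext fun a => (hr a).symm
    rw [this]
    exact H.comp r))
  refine ⟨σ, fun i => ?_⟩
  rw [hσ ⟨g i, i, rfl⟩]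
  exact (H.eq_iff _ _).2 (hr ⟨g i, i, rfl⟩)

theorem IsMonster.exists_equiv_over (hC : IsMonster L C kbar) {ι : Type*} {B : Set C}
    {f g : ι → C} (hs : #(B ∪ range g : Set C) < kbar) (H : SameTypeOver L B f g) :
    ∃ σ : C ≃[L] C, (∀ b ∈ B, σ b = b) ∧ ∀ i, σ (g i) = f i := by
  obtain ⟨σ, hσ⟩ := hC.exists_equiv (by simpa [Sum.elim_range] using hs) (sameTypeOver_iff.1 H)
  exact ⟨σ, fun b hb => hσ (.inl ⟨b, hb⟩), fun i => hσ (.inr i)⟩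

theorem sameTypeOver_of_realizes {A : Set C} {q : TypeOver L A} {c d : C} (hc : Realizes q c)
    (hd : Realizes q d) : SameTypeOver L A (fun _ : Fin 1 => d) (fun _ => c) := by
  intro φ
  rw [← Theory.CompleteType.formula_mem_typeOf (T := (L[[A]]).completeTheory C), hd, ← hc,
    Theory.CompleteType.formula_mem_typeOf]

theorem IsMonster.exists_equiv_of_realizes (hC : IsMonster L C kbar) {A : Set C}
    {q : TypeOver L A} {c d : C} (hA : #(insert c A : Set C) < kbar) (hc : Realizes q c)
    (hd : Realizes q d) : ∃ σ : C ≃[L] C, (∀ b ∈ A, σ b = b) ∧ σ c = d := by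
  obtain ⟨σ, h1, h2⟩ := hC.exists_equiv_over (by simpa using hA) (sameTypeOver_of_realizes hc hd)
  exact ⟨σ, h1, h2 0⟩

/-- By saturation, a partial elementary map from a structure to a monster model, with small image,
extends to one more element. -/
theorem IsMonster.exists_extend_one (hC : IsMonster L C kbar) {N : Type*} [L.Structure N]
    {A : Set C} (hA : #A < kbar) {g : A → N} (H : SameTy L g (Subtype.val : A → C)) (d : N) :
    ∃ c : C, SameTy L (Sum.elim g fun _ : Fin 1 => d)
      (Sum.elim (Subtype.val : A → C) fun _ : Fin 1 => c) := by
  let := constantsOn.structure g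
  have : Nonempty N := ⟨d⟩
  have hmod : N ⊨ (L[[A]]).completeTheory C := by
    rw [Theory.model_iff]
    intro φ hφ
    rw [Language.mem_completeTheory] at hφ
    rw [← Formula.realize_equivSentence_symm_con] at hφ ⊢
    exact (H _).2 hφ
  obtain ⟨c, hc⟩ := hC.saturated A hA
    (((L[[A]]).completeTheory C).typeOf (fun _ : Fin 1 => d))
  refine ⟨c, fun φ => ?_⟩
  have e1 := BoundedFormula.realize_constantsVarsEquiv (L := L)
    (φ := BoundedFormula.constantsVarsEquiv.symm φ) (v := fun _ : Fin 1 => d) (xs := default)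
  have e2 := BoundedFormula.realize_constantsVarsEquiv (L := L)
    (φ := BoundedFormula.constantsVarsEquiv.symm φ) (v := fun _ : Fin 1 => c) (xs := default)
  rw [Equiv.apply_symm_apply] at e1 e2
  refine e1.trans (Iff.trans ?_ e2.symm)
  set ψ : (L[[A]]).Formula (Fin 1) := BoundedFormula.constantsVarsEquiv.symm φ
  change ψ.Realize _ ↔ ψ.Realize _
  rw [← Theory.CompleteType.formula_mem_typeOf (T := (L[[A]]).completeTheory C), ← hc,
    Theory.CompleteType.formula_mem_typeOf]

theorem IsMonster.exists_extend (hC : IsMonster L C kbar) {N ι : Type*} [L.Structure N]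
    {g : ι → N} {h : ι → C} (hh : #(range h) < kbar) (H : SameTy L g h) (d : N) :
    ∃ c : C, SameTy L (Sum.elim g fun _ : Fin 1 => d) (Sum.elim h fun _ : Fin 1 => c) := by
  choose r hr using fun a : range h => a.2
  have hr' : (Subtype.val : range h → C) = h ∘ r := funext fun a => (hr a).symm
  obtain ⟨c, hc⟩ := hC.exists_extend_one hh (g := g ∘ r) (by rw [hr']; exact H.comp r) d
  refine ⟨c, ?_⟩
  have := hc.comp (Sum.map (rangeFactorization h) (id : Fin 1 → Fin 1))
  convert this using 1
  · funext x
    rcases x with x | x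
    · exact (H.eq_iff _ _).2 (hr (rangeFactorization h x)).symm
    · rfl
  · funext x
    rcases x with x | x <;> rfl

/-- A partial elementary map from a structure to a monster model, with small image, extends to
finitely many more elements. -/
theorem IsMonster.exists_extend_tuple (hC : IsMonster L C kbar) (hk : ℵ₀ ≤ kbar)
    {N ι β : Type*} [L.Structure N] [Finite β]
    {g : ι → N} {h : ι → C} (hh : #(range h) < kbar) (H : SameTy L g h) (d : β → N) :
    ∃ c : β → C, SameTy L (Sum.elim g d) (Sum.elim h c) := by
  obtain ⟨n, ⟨e⟩⟩ := Finite.exists_equiv_fin β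
  have key : ∀ n, ∀ d : Fin n → N, ∃ c : Fin n → C, SameTy L (Sum.elim g d) (Sum.elim h c) := by
    intro n
    induction n with
    | zero =>
      intro d
      refine ⟨Fin.elim0, ?_⟩
      have := H.comp (Sum.elim id Fin.elim0 : ι ⊕ Fin 0 → ι)
      convert this using 1 <;>
      · funext x
        rcases x with x | x
        · rfl
        · exact x.elim0
    | succ n ih =>
      intro d
      obtain ⟨c, hc⟩ := ih (fun i => d i.castSucc)
      obtain ⟨x, hx⟩ := hC.exists_extend (by
        rw [Sum.elim_range]
        exact (mk_union_le _ _).trans_lt (add_lt_of_lt hk hh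
          ((lt_aleph0_iff_set_finite.2 (finite_range c)).trans_le hk))) hc (d (Fin.last n))
      refine ⟨Fin.snoc c x, ?_⟩
      have := hx.comp (Sum.elim (fun i => .inl (.inl i))
        (Fin.snoc (fun i => .inl (.inr i)) (.inr 0)) : ι ⊕ Fin (n + 1) → (ι ⊕ Fin n) ⊕ Fin 1)
      convert this using 1 <;>
      · funext y
        rcases y with y | y
        · rfl
        · refine Fin.lastCases ?_ (fun i => ?_) y <;> simp
  obtain ⟨c, hc⟩ := key n (d ∘ e.symm)
  refine ⟨c ∘ e, ?_⟩
  have := hc.comp (Sum.map id e)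
  convert this using 1 <;>
  · funext y
    rcases y with y | y <;> simp

/-- Compactness: if every formula `φ` in the type of `c` over `A` has realizations `d j`, for `j`
in a finite index set, which satisfy jointly the formula `θ`, then `A`-conjugates
of `c` in the monster model can be found which jointly satisfy `θ`. -/
theorem IsMonster.exists_conjugates (hC : IsMonster L C kbar) (hk : ℵ₀ ≤ kbar) {A : Set C}
    (hA : #A < kbar) {J K : Type} [Finite J] [Finite K] (c : K → C) (θ : L.Formula (J × K))
    (H : ∀ φ : L.Formula (A ⊕ K), φ.Realize (Sum.elim Subtype.val c) →
      ∃ d : J → K → C, (∀ j, φ.Realize (Sum.elim Subtype.val (d j))) ∧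
        θ.Realize fun p => d p.1 p.2) :
    ∃ d : J → K → C, (∀ j, SameTypeOver L A (d j) c) ∧ θ.Realize fun p => d p.1 p.2 := by
  classical
  let I := {φ : L.Formula (A ⊕ K) // φ.Realize (Sum.elim (Subtype.val : A → C) c)}
  let S : I → Set I := fun φ =>
    {ψ | ∀ v : A ⊕ K → C, ψ.1.Realize v → φ.1.Realize v}
  -- The sets `S φ` of the conditions stronger than `φ` generate a proper filter on `I`.
  have hfip : ∀ T : Set (Set I), T ⊆ range S → T.Finite → (⋂₀ T).Nonempty := by
    intro T hT hTf
    induction T, hTf using Set.Finite.induction_on with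
    | empty => exact ⟨⟨⊤, by simp⟩, by simp⟩
    | @insert a s _ _ ih =>
      obtain ⟨φ, rfl⟩ := hT (mem_insert _ _)
      obtain ⟨ψ, hψ⟩ := ih ((subset_insert _ _).trans hT)
      refine ⟨⟨φ.1 ⊓ ψ.1, Formula.realize_inf.2 ⟨φ.2, ψ.2⟩⟩, ?_⟩
      rw [sInter_insert]
      refine ⟨fun v hv => (Formula.realize_inf.1 hv).1, fun t ht => ?_⟩
      obtain ⟨χ, rfl⟩ := hT (mem_insert_of_mem _ ht)
      exact fun v hv => hψ _ ht v (Formula.realize_inf.1 hv).2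
  have : (Filter.generate (range S)).NeBot := Filter.generate_neBot_iff.2 hfip
  let U : Ultrafilter I := Ultrafilter.of (Filter.generate (range S))
  have hU : ∀ φ : I, ∀ᶠ ψ in (U : Filter I), ψ ∈ S φ := fun φ =>
    Ultrafilter.of_le _ (Filter.mem_generate_of_mem (mem_range_self φ))
  choose t ht hθ using fun ψ : I => H ψ.1 ψ.2
  let N := (U : Filter I).Product fun _ => C
  let toN : (I → C) → N := fun x => (x : N)
  -- Łoś's theorem, in the two universes of variables in which it is used.
  have los : ∀ {β : Type w} (φ : L.Formula β) (x : β → I → C),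
      (φ.Realize fun i => toN (x i)) ↔ ∀ᶠ ψ in (U : Filter I), φ.Realize fun i => x i ψ :=
    fun φ x => Ultraproduct.realize_formula_cast φ x
  have los₀ : ∀ {β : Type} (φ : L.Formula β) (x : β → I → C),
      (φ.Realize fun i => toN (x i)) ↔ ∀ᶠ ψ in (U : Filter I), φ.Realize fun i => x i ψ :=
    fun φ x => Ultraproduct.realize_formula_cast φ x
  let g : A → N := fun a => toN fun _ => a
  let d : J × K → N := fun p => toN fun ψ => t ψ p.1 p.2
  have hg : SameTy L g (Subtype.val : A → C) := fun φ => by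
    refine (los φ fun a _ => (a : C)).trans ?_
    simp
  have hr : range (Subtype.val : A → C) = A := Subtype.range_val
  obtain ⟨e, he⟩ := hC.exists_extend_tuple hk (by rw [hr]; exact hA) hg d
  refine ⟨fun j k => e (j, k), fun j => ?_, ?_⟩
  · rw [sameTypeOver_iff]
    have key : ∀ φ : L.Formula (A ⊕ K), φ.Realize (Sum.elim (Subtype.val : A → C) c) →
        φ.Realize (Sum.elim (Subtype.val : A → C) fun k => e (j, k)) := by
      intro φ hφ
      have h1 := (he.comp (Sum.map id (fun k => (j, k)) : A ⊕ K → A ⊕ (J × K))) φ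
      have h2 : (Sum.elim (Subtype.val : A → C) e) ∘ Sum.map id (fun k => (j, k)) =
          Sum.elim (Subtype.val : A → C) fun k => e (j, k) := by
        funext x; rcases x with x | x <;> rfl
      have h3 : (Sum.elim g d) ∘ Sum.map id (fun k => (j, k)) =
          fun x : A ⊕ K => toN fun ψ => Sum.elim (Subtype.val : A → C) (t ψ j) x := by
        funext x; rcases x with x | x <;> rfl
      rw [h2, h3, los] at h1
      exact h1.1 ((hU ⟨φ, hφ⟩).mono fun ψ hψ => hψ _ (ht ψ j))
    intro φ
    refine ⟨fun h => ?_, key φ⟩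
    by_contra h'
    exact Formula.realize_not.1 (key φ.not (Formula.realize_not.2 h')) h
  · have h1 := (he.comp Sum.inr) θ
    exact h1.1 ((los₀ θ fun p ψ => t ψ p.1 p.2).2 (Filter.Eventually.of_forall hθ))

end Monster

/-- Universal sentences with parameters transfer between an elementary substructure and the
ambient structure. -/
theorem forall_realize_iff {C : Type*} [L.Structure C] (M : L.ElementarySubstructure C)
    {α β : Type*} [Finite β] (ψ : L.Formula (α ⊕ β)) (a : α → M) :
    (∀ v : β → C, ψ.Realize (Sum.elim (fun i => (a i : C)) v)) ↔
      ∀ v : β → M, ψ.Realize (Sum.elim a v) := by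
  rw [← Formula.realize_iAlls, ← Formula.realize_iAlls]
  exact sameTy_elementarySubstructure M a _

end ModelTheory

/-! ### The calculus of independence -/

section Calculus

variable {L : FirstOrder.Language.{u, v}} {C : Type w} [L.Structure C]

/-- The automorphism `σ` fixes the set `A` pointwise. -/
def Fixes (σ : C ≃[L] C) (A : Set C) : Prop := ∀ a ∈ A, σ a = a

theorem Fixes.mono {σ : C ≃[L] C} {A B : Set C} (h : Fixes σ A) (hB : B ⊆ A) : Fixes σ B :=
  fun b hb => h b (hB hb)

theorem Fixes.image {σ : C ≃[L] C} {A : Set C} (h : Fixes σ A) : σ '' A = A := by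
  ext x
  constructor
  · rintro ⟨a, ha, rfl⟩
    rwa [h a ha]
  · exact fun hx => ⟨x, hx, h x hx⟩

theorem Fixes.comp {σ τ : C ≃[L] C} {A : Set C} (h : Fixes τ A) (h' : Fixes σ A) :
    Fixes (τ.comp σ) A := fun a ha => by rw [Equiv.comp_apply, h' a ha, h a ha]

theorem image_comp_equiv (σ τ : C ≃[L] C) (A : Set C) : τ.comp σ '' A = τ '' (σ '' A) := by
  ext x
  simp [Equiv.comp_apply]

theorem image_symm_image (σ : C ≃[L] C) (A : Set C) : σ.symm '' (σ '' A) = A := by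
  ext x
  simp

theorem mk_image_equiv (σ : C ≃[L] C) (A : Set C) : #(σ '' A) = #A :=
  mk_image_eq σ.injective

variable (L) in
/-- The calculus of independence in a monster model, as it is used below: unlike in
`IsIndependenceRelation`, the relation `R` is required to hold of small sets only,
so that its consequences need no side conditions on cardinalities. -/
structure IndCalculus (kbar : Cardinal.{w}) (R : Set C → Set C → Set C → Prop) : Prop where
  infinite : ℵ₀ ≤ kbar
  small : ∀ {A B D : Set C}, R A B D → #A < kbar ∧ #B < kbar ∧ #D < kbar
  image : ∀ {A B D : Set C} (σ : C ≃[L] C), R A B D → R (σ '' A) (σ '' B) (σ '' D)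
  symm : ∀ {A B D : Set C}, R A B D → R D B A
  union_base : ∀ {A B D : Set C}, R A B D → R (A ∪ B) B D
  mono_left : ∀ {A A' B D : Set C}, R A B D → A' ⊆ A → R A' B D
  base_mono : ∀ {A B D E : Set C}, R A B E → B ⊆ D → D ⊆ E → R A D E
  trans : ∀ {A B D E : Set C}, R A B D → R A D E → B ⊆ D → D ⊆ E → R A B E
  of_finite : ∀ {A B D : Set C}, #A < kbar → #B < kbar → #D < kbar →
    (∀ A₀ : Set C, A₀ ⊆ A → A₀.Finite → R A₀ B D) → R A B D
  extension : ∀ {A B D : Set C}, #A < kbar → #B < kbar → #D < kbar →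
    ∃ σ : C ≃[L] C, Fixes σ B ∧ R (σ '' A) B D

namespace IndCalculus

variable {kbar : Cardinal.{w}} {R : Set C → Set C → Set C → Prop} {A B D E A' D' : Set C}

theorem mono_right (hR : IndCalculus L kbar R) (h : R A B D) (hD : D' ⊆ D) : R A B D' :=
  hR.symm (hR.mono_left (hR.symm h) hD)

theorem union_base_right (hR : IndCalculus L kbar R) (h : R A B D) : R A B (B ∪ D) :=
  hR.mono_right (hR.symm (hR.union_base (hR.symm h))) (union_comm B D).subset

theorem trans_right (hR : IndCalculus L kbar R) (h : R A B D) (h' : R A (B ∪ D) E) :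
    R A B (B ∪ D ∪ E) :=
  hR.trans (hR.union_base_right h) (hR.union_base_right h') subset_union_left subset_union_left

theorem trans_left (hR : IndCalculus L kbar R) (h : R A B D) (h' : R E (B ∪ A) D) :
    R (B ∪ A ∪ E) B D :=
  hR.symm (hR.trans_right (hR.symm h) (hR.symm h'))

theorem base_mono_right (hR : IndCalculus L kbar R) (h : R A B D) (hE : E ⊆ D) :
    R A (B ∪ E) D :=
  hR.mono_right (hR.base_mono (hR.union_base_right h) subset_union_left
    (union_subset_union_right B hE)) subset_union_right

theorem base_mono_left (hR : IndCalculus L kbar R) (h : R A B D) (hE : E ⊆ A) :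
    R A (B ∪ E) D :=
  hR.symm (hR.base_mono_right (hR.symm h) hE)

/-- Every set is independent over `B` from `B` itself: by extension, this holds of a conjugate. -/
theorem base_right (hR : IndCalculus L kbar R) (hA : #A < kbar) (hB : #B < kbar) : R A B B := by
  obtain ⟨σ, hσ, h⟩ := hR.extension hA hB hB
  have := hR.image σ.symm h
  rw [image_symm_image] at this
  have h2 : σ.symm '' B = B := by
    conv_lhs => rw [← hσ.image]
    exact image_symm_image σ B
  rwa [h2] at this

end IndCalculus

theorem mk_union_lt {kbar : Cardinal.{w}} (hk : ℵ₀ ≤ kbar) {A B : Set C} (hA : #A < kbar)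
    (hB : #B < kbar) : #(A ∪ B : Set C) < kbar :=
  (mk_union_le _ _).trans_lt (add_lt_of_lt hk hA hB)

theorem mk_lt_of_finite {kbar : Cardinal.{w}} (hk : ℵ₀ ≤ kbar) {A : Set C} (hA : A.Finite) :
    #A < kbar :=
  (lt_aleph0_iff_set_finite.2 hA).trans_le hk

theorem mk_lt_of_subset {kbar : Cardinal.{w}} {A B : Set C} (h : A ⊆ B) (hB : #B < kbar) :
    #A < kbar :=
  (mk_le_mk_of_subset h).trans_lt hB

/-- An independence relation, restricted to small sets, obeys the calculus of independence. -/
theorem IsIndependenceRelation.indCalculus [Nonempty C] {kbar : Cardinal.{w}}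
    {Ind : Set C → Set C → Set C → Prop} (hI : IsIndependenceRelation L kbar Ind)
    (hC : IsMonster L C kbar) (hk : ℵ₀ ≤ kbar) :
    IndCalculus L kbar fun A B D => (#A < kbar ∧ #B < kbar ∧ #D < kbar) ∧ Ind A B D where
  infinite := hk
  small h := h.1
  image := by
    rintro A B D σ ⟨⟨hA, hB, hD⟩, h⟩
    simp only [mk_image_equiv]
    exact ⟨⟨hA, hB, hD⟩, hI.invariance _ _ _ hA hB hD σ h⟩
  symm := by
    rintro A B D ⟨⟨hA, hB, hD⟩, h⟩
    exact ⟨⟨hD, hB, hA⟩, hI.symmetry _ _ _ hA hB hD h⟩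
  union_base := by
    rintro A B D ⟨⟨hA, hB, hD⟩, h⟩
    exact ⟨⟨mk_union_lt hk hA hB, hB, hD⟩, hI.normality _ _ _ hA hD hB h⟩
  mono_left := by
    rintro A A' B D ⟨⟨hA, hB, hD⟩, h⟩ hs
    have hA' := mk_lt_of_subset hs hA
    refine ⟨⟨hA', hB, hD⟩, (hI.finite_character _ _ _ hA' hB hD).2 fun A₀ h₀ hf => ?_⟩
    exact (hI.finite_character _ _ _ hA hB hD).1 h A₀ (h₀.trans hs) hf
  base_mono := by
    rintro A B D E ⟨⟨hA, hB, hE⟩, h⟩ h1 h2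
    have hD := mk_lt_of_subset h2 hE
    exact ⟨⟨hA, hD, hE⟩, ((hI.transitivity _ _ _ _ hA hB hD hE h1 h2).1 h).2⟩
  trans := by
    rintro A B D E ⟨⟨hA, hB, hD⟩, h⟩ ⟨⟨_, _, hE⟩, h'⟩ h1 h2
    exact ⟨⟨hA, hB, hE⟩, (hI.transitivity _ _ _ _ hA hB hD hE h1 h2).2 ⟨h, h'⟩⟩
  of_finite hA hB hD h :=
    ⟨⟨hA, hB, hD⟩, (hI.finite_character _ _ _ hA hB hD).2 fun A₀ h1 h2 => (h A₀ h1 h2).2⟩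
  extension := by
    intro A B D hA hB hD
    obtain ⟨f, hf, h⟩ := hI.extension A B D hA hB hD
    obtain ⟨σ, h1, h2⟩ := hC.exists_equiv_over
      (by rw [Subtype.range_coe]; exact mk_union_lt hk hB hA) hf
    have : range f = σ '' A := by
      rw [← image_univ, ← funext h2, ← image_image, image_univ, Subtype.range_coe]
    refine ⟨σ, h1, ?_⟩
    rw [← this]
    refine ⟨⟨?_, hB, hD⟩, h⟩
    rw [this, mk_image_equiv]
    exact hA

/-- The local character of independence, for finite sets on the left. -/
theorem IsIndependenceRelation.kappaZero_spec {kbar : Cardinal.{w}} (hk : ℵ₀ ≤ kbar)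
    {Ind : Set C → Set C → Set C → Prop} (hI : IsIndependenceRelation L kbar Ind) :
    (kappaZero kbar Ind).IsRegular ∧ ∀ A B : Set C, A.Finite → #B < kbar →
      ∃ B₀ ⊆ B, #B₀ < kappaZero kbar Ind ∧ Ind A B₀ B := by
  have hne : {k : Cardinal.{w} | k.IsRegular ∧ ∀ A B : Set C, A.Finite → #B < kbar →
      ∃ B₀ ⊆ B, #B₀ < k ∧ Ind A B₀ B}.Nonempty := by
    obtain ⟨k, _, h⟩ := hI.local_character
    refine ⟨Order.succ (max ℵ₀ k), isRegular_succ (le_max_left _ _), fun A B hA hB => ?_⟩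
    obtain ⟨D, hD, hlt, hInd⟩ := h A B (mk_lt_of_finite hk hA) hB
    refine ⟨D, hD, hlt.trans_le ?_, hInd⟩
    refine add_le_of_le ((le_max_left _ _).trans (Order.le_succ _))
      ((le_max_right _ _).trans (Order.le_succ _)) ?_
    exact Order.succ_le_succ ((lt_aleph0_iff_set_finite.2 hA).le.trans (le_max_left _ _))
  exact csInf_mem hne

/-- Construction of an automorphism by transfinite recursion: if automorphisms fixing `A` for which
the image of a subset of `B` has the property `Q` can be modified so as to accommodate one more
element of `B`, then some automorphism fixing `A` maps `B` onto a set with the property `Q`. -/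
theorem IsMonster.exists_equiv_of_step [Nonempty C] {kbar : Cardinal.{w}}
    (hC : IsMonster L C kbar) {A B : Set C}
    (hAB : #(A ∪ B : Set C) < kbar) {Q : Set C → Prop} (hQ₀ : Q ∅)
    (hQmono : ∀ S T, Q S → T ⊆ S → Q T)
    (hQfin : ∀ S : Set C, #S ≤ #B → (∀ T : Set C, T ⊆ S → T.Finite → Q T) → Q S)
    (step : ∀ (S : Set C) (σ : C ≃[L] C) (d : C), S ⊆ B → d ∈ B → Fixes σ A → Q (σ '' S) →
      ∃ τ : C ≃[L] C, Fixes τ A ∧ (∀ s ∈ S, τ s = σ s) ∧ Q (τ '' insert d S)) :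
    ∃ σ : C ≃[L] C, Fixes σ A ∧ Q (σ '' B) := by
  -- Zorn's lemma is applied to the graphs of restrictions of automorphisms to subsets of `B`.
  let good : Set (Set (C × C)) := {G | ∃ (S : Set C) (σ : C ≃[L] C),
    S ⊆ B ∧ Fixes σ A ∧ Q (σ '' S) ∧ G = (fun s => (s, σ s)) '' S}
  have hempty : (∅ : Set (C × C)) ∈ good :=
    ⟨∅, Language.Equiv.refl L C, empty_subset _, fun _ _ => rfl, by simpa using hQ₀, by simp⟩
  obtain ⟨G, -, hG⟩ := zorn_subset_nonempty good (by
    intro c hc hchain hne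
    refine ⟨⋃₀ c, ?_, fun s hs => subset_sUnion_of_mem hs⟩
    have hfin : ∀ T : Set (C × C), T.Finite → T ⊆ ⋃₀ c → ∃ G ∈ c, T ⊆ G := fun T hT hTc =>
      hchain.directedOn.exists_mem_subset_of_finite_of_subset_sUnion hne hT hTc
    have hfst : ∀ p ∈ ⋃₀ c, p.1 ∈ B := by
      rintro p ⟨G, hG, hp⟩
      obtain ⟨S, σ, hS, -, -, rfl⟩ := hc hG
      obtain ⟨s, hs, rfl⟩ := hp
      exact hS hs
    let g : A ⊕ (⋃₀ c : Set (C × C)) → C := Sum.elim Subtype.val fun p => p.1.1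
    let f : A ⊕ (⋃₀ c : Set (C × C)) → C := Sum.elim Subtype.val fun p => p.1.2
    have hrg : range g ⊆ A ∪ B := by
      rintro _ ⟨x | x, rfl⟩
      · exact .inl x.2
      · exact .inr (hfst _ x.2)
    have hty : SameTy L f g := by
      refine sameTy_of_finite fun s => ?_
      obtain ⟨G, hG, hsG⟩ := hfin
        ((Subtype.val : (⋃₀ c : Set (C × C)) → C × C) ''
          (Sum.inr ⁻¹' (s : Set (A ⊕ (⋃₀ c : Set (C × C))))))
        ((s.finite_toSet.preimage Sum.inr_injective.injOn).image Subtype.val)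
        (by rintro _ ⟨p, -, rfl⟩; exact p.2)
      obtain ⟨S, σ, hS, hσ, -, rfl⟩ := hc hG
      have : (fun i : s => f i) = σ ∘ fun i : s => g i := by
        funext ⟨i, hi⟩
        rcases i with a | p
        · exact (hσ a a.2).symm
        · obtain ⟨t, -, ht⟩ := hsG ⟨p, hi, rfl⟩
          change p.1.2 = σ p.1.1
          rw [← ht]
      rw [this]
      exact sameTy_equiv σ _
    obtain ⟨σ, hσ⟩ := hC.exists_equiv (mk_lt_of_subset hrg hAB) hty
    have hσ' : ∀ p ∈ ⋃₀ c, σ p.1 = p.2 := fun p hp => hσ (.inr ⟨p, hp⟩)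
    refine ⟨Prod.fst '' ⋃₀ c, σ, ?_, fun a ha => hσ (.inl ⟨a, ha⟩), ?_, ?_⟩
    · rintro _ ⟨p, hp, rfl⟩
      exact hfst p hp
    · refine hQfin _ ?_ fun T hT hTf => ?_
      · rw [mk_image_equiv]
        refine mk_le_mk_of_subset ?_
        rintro _ ⟨p, hp, rfl⟩
        exact hfst p hp
      · rw [image_image] at hT
        obtain ⟨T', hT', hT'f, rfl⟩ := exists_subset_image_finite_and.1
          ⟨T, hT, hTf, rfl⟩
        obtain ⟨G, hG, hsG⟩ := hfin T' hT'f hT'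
        obtain ⟨S, τ, hS, hτ, hQ, rfl⟩ := hc hG
        refine hQmono _ _ hQ ?_
        rintro _ ⟨p, hp, rfl⟩
        obtain ⟨s, hs, rfl⟩ := hsG hp
        exact ⟨s, hs, (hσ' _ (hT' hp)).symm⟩
    · rw [image_image]
      ext p
      constructor
      · exact fun hp => ⟨p, hp, Prod.ext rfl (hσ' p hp)⟩
      · rintro ⟨q, hq, rfl⟩
        change (q.1, σ q.1) ∈ _
        rw [hσ' q hq]
        exact hq) ∅ hempty
  obtain ⟨S, σ, hS, hσ, hQ, hGS⟩ := hG.prop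
  have hSB : B ⊆ S := by
    intro d hd
    obtain ⟨τ, hτ, hτσ, hQτ⟩ := step S σ d hS hd hσ hQ
    have hle : G ⊆ (fun s => (s, τ s)) '' insert d S := by
      rw [hGS]
      rintro _ ⟨s, hs, rfl⟩
      exact ⟨s, mem_insert_of_mem _ hs, by simp [hτσ s hs]⟩
    have hge := hG.le_of_ge ⟨insert d S, τ, insert_subset hd hS, hτ, hQτ, rfl⟩ hle
    obtain ⟨s, hs, h⟩ := hGS ▸ hge ⟨d, mem_insert _ _, rfl⟩
    exact (show s = d from (Prod.ext_iff.1 h).1) ▸ hs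
  exact ⟨σ, hσ, hS.antisymm hSB ▸ hQ⟩

end Calculus

/-! ### Maps between independent subsets of a lovely pair -/

section Lovely

variable {L : FirstOrder.Language.{u, v}} {C : Type w} [L.Structure C]

variable (L) in
/-- The lovely pair `(M, P)`, described by subsets of the monster model and with types over small
sets replaced by orbits of automorphisms. -/
structure LovelyCalculus (kbar kappa : Cardinal.{w}) (R : Set C → Set C → Set C → Prop)
    (M P : Set C) : Prop where
  infinite : ℵ₀ ≤ kappa
  lt : kappa < kbar
  subset : P ⊆ M
  small : #M < kbar
  local_character : ∀ A B : Set C, A.Finite → #B < kbar → ∃ B₀ ⊆ B, #B₀ < kappa ∧ R A B₀ B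
  density : ∀ A ⊆ M, #A < kappa → ∀ c : C, R {c} (A ∩ P) A → ∃ σ : C ≃[L] C, Fixes σ A ∧ σ c ∈ P
  extension : ∀ A ⊆ M, #A < kappa → ∀ c : C, ∃ σ : C ≃[L] C, Fixes σ A ∧ σ c ∈ M ∧ R {σ c} A P

/-- The set `X` is a very small subset of `M` which is `P`-independent, as witnessed by the subset
`Q` of `X ∩ P`. -/
structure Free (kappa : Cardinal.{w}) (R : Set C → Set C → Set C → Prop) (M P X Q : Set C) :
    Prop where
  subset : X ⊆ M
  base_subset : Q ⊆ X
  base_subset_P : Q ⊆ P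
  small : #X < kappa
  indep : R X Q P

/-- The restriction of the automorphism `σ` to `X` is a partial elementary map between very small
`P`-independent subsets of `M`, and it carries the witness `Q ⊆ X ∩ P` to such a witness. -/
structure FreeMap (kappa : Cardinal.{w}) (R : Set C → Set C → Set C → Prop) (M P : Set C)
    (σ : C ≃[L] C) (X Q : Set C) : Prop where
  source : Free kappa R M P X Q
  target : Free kappa R M P (σ '' X) (σ '' Q)

theorem FreeMap.symm {kappa : Cardinal.{w}} {R : Set C → Set C → Set C → Prop} {M P : Set C}
    {σ : C ≃[L] C} {X Q : Set C} (h : FreeMap kappa R M P σ X Q) :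
    FreeMap kappa R M P σ.symm (σ '' X) (σ '' Q) :=
  ⟨h.target, by simpa only [image_symm_image] using h.source⟩

namespace LovelyCalculus

variable {kbar kappa : Cardinal.{w}} {R : Set C → Set C → Set C → Prop} {M P : Set C}

/-- Membership in `P` can be read off from independence. -/
theorem mem_iff (hP : LovelyCalculus L kbar kappa R M P) (hR : IndCalculus L kbar R)
    {X Q : Set C} (hX : Free kappa R M P X Q) {x : C} (hx : x ∈ X) : x ∈ P ↔ R {x} Q {x} := by
  constructor
  · intro hxP
    exact hR.mono_left (hR.mono_right hX.indep (singleton_subset_iff.2 hxP))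
      (singleton_subset_iff.2 hx)
  · intro h
    by_contra hxP
    have hQx : Q ∪ {x} ⊆ X := union_subset hX.base_subset (singleton_subset_iff.2 hx)
    have hcap : (Q ∪ {x}) ∩ P = Q := by
      ext y
      constructor
      · rintro ⟨hy | rfl, hyP⟩
        · exact hy
        · exact absurd hyP hxP
      · exact fun hy => ⟨.inl hy, hX.base_subset_P hy⟩
    -- The type of `x` over `Q ∪ {x}` has no realization besides `x`.
    obtain ⟨σ, hσ, hσP⟩ := hP.density (Q ∪ {x}) (hQx.trans hX.subset)
      (mk_lt_of_subset hQx hX.small) x (by rw [hcap]; exact hR.union_base_right h)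
    exact hxP (hσ x (.inr rfl) ▸ hσP)

theorem mem_iff_image_mem (hP : LovelyCalculus L kbar kappa R M P) (hR : IndCalculus L kbar R)
    {X Q : Set C} {σ : C ≃[L] C} (h : FreeMap kappa R M P σ X Q) {x : C} (hx : x ∈ X) :
    x ∈ P ↔ σ x ∈ P := by
  rw [hP.mem_iff hR h.source hx, hP.mem_iff hR h.target (mem_image_of_mem σ hx)]
  constructor
  · intro hxx
    simpa using hR.image σ hxx
  · intro hxx
    simpa [image_symm_image] using hR.image σ.symm hxx

/-- Every very small `P`-independent set can be enlarged to one that contains a given element. -/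
theorem exists_free_insert (hP : LovelyCalculus L kbar kappa R M P) (hR : IndCalculus L kbar R)
    {X Q : Set C} (hX : Free kappa R M P X Q) {m : C} (hm : m ∈ M) :
    ∃ X' Q', Free kappa R M P X' Q' ∧ X ⊆ X' ∧ Q ⊆ Q' ∧ m ∈ X' := by
  have hPs : #P < kbar := mk_lt_of_subset hP.subset hP.small
  obtain ⟨B, hB, hBk, hmB⟩ := hP.local_character {m} (X ∪ P) (finite_singleton m)
    (mk_union_lt hR.infinite (hX.small.trans hP.lt) hPs)
  have hD : R {m} (X ∪ (B ∩ P)) P := by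
    refine hR.mono_right (hR.base_mono hmB (fun b hb => ?_) ?_) subset_union_right
    · rcases hB hb with h | h
      · exact .inl h
      · exact .inr ⟨hb, h⟩
    · exact union_subset_union_right X inter_subset_right
  have hXQ : R (X ∪ (Q ∪ (B ∩ P))) (Q ∪ (B ∩ P)) P :=
    hR.union_base (hR.base_mono_right hX.indep inter_subset_right)
  have hXD : Q ∪ (B ∩ P) ∪ (X ∪ (Q ∪ (B ∩ P))) = X ∪ (B ∩ P) := by
    ext y
    have := @hX.base_subset y
    simp only [mem_union]
    tauto
  have h := hR.trans_left hXQ (E := {m}) (by rw [hXD]; exact hD)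
  rw [hXD] at h
  refine ⟨X ∪ (B ∩ P) ∪ {m}, Q ∪ (B ∩ P), ⟨?_, ?_, ?_, ?_, h⟩, ?_, subset_union_left, .inr rfl⟩
  · exact union_subset (union_subset hX.subset (inter_subset_right.trans hP.subset))
      (singleton_subset_iff.2 hm)
  · exact (union_subset_union_left _ hX.base_subset).trans subset_union_left
  · exact union_subset hX.base_subset_P inter_subset_right
  · exact mk_union_lt hP.infinite (mk_union_lt hP.infinite hX.small
      (mk_lt_of_subset inter_subset_left hBk)) (mk_lt_of_finite hP.infinite (finite_singleton m))
  · exact subset_union_left.trans subset_union_left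

theorem exists_free_union (hP : LovelyCalculus L kbar kappa R M P) (hR : IndCalculus L kbar R)
    {X Q T : Set C} (hX : Free kappa R M P X Q) (hT : T.Finite) (hTM : T ⊆ M) :
    ∃ X' Q', Free kappa R M P X' Q' ∧ X ⊆ X' ∧ Q ⊆ Q' ∧ T ⊆ X' := by
  induction T, hT using Set.Finite.induction_on with
  | empty => exact ⟨X, Q, hX, Subset.rfl, Subset.rfl, empty_subset _⟩
  | @insert m T _ _ ih =>
    obtain ⟨X₁, Q₁, h, hXX, hQQ, hTX⟩ := ih ((subset_insert _ _).trans hTM)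
    obtain ⟨X₂, Q₂, h', hXX', hQQ', hm⟩ := hP.exists_free_insert hR h (hTM (mem_insert _ _))
    exact ⟨X₂, Q₂, h', hXX.trans hXX', hQQ.trans hQQ', insert_subset hm (hTX.trans hXX')⟩

/-- The density property for sets in place of elements. -/
theorem exists_image_subset_P [Nonempty C] (hP : LovelyCalculus L kbar kappa R M P)
    (hR : IndCalculus L kbar R) (hC : IsMonster L C kbar) {A D : Set C} (hA : A ⊆ M)
    (hAk : #A < kappa) (hDk : #D < kappa) (h : R D (A ∩ P) A) :
    ∃ σ : C ≃[L] C, Fixes σ A ∧ σ '' D ⊆ P := by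
  refine hC.exists_equiv_of_step (Q := fun S => S ⊆ P)
    ((mk_union_lt hP.infinite hAk hDk).trans hP.lt) (empty_subset _)
    (fun _ _ hS hT => hT.trans hS)
    (fun S _ hS x hx => hS {x} (singleton_subset_iff.2 hx) (finite_singleton x) rfl) ?_
  intro S σ d hS hd hσ hσS
  have h1 : R {d} (A ∩ P ∪ S) A :=
    hR.mono_left (hR.base_mono_left h hS) (singleton_subset_iff.2 hd)
  have h2 : R {d} (A ∩ P ∪ S) (A ∪ S) := by
    refine hR.mono_right (hR.union_base_right h1) ?_
    rintro x (hx | hx)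
    · exact .inr hx
    · exact .inl (.inr hx)
  have h3 := hR.image σ h2
  rw [image_union, image_union, (hσ.mono inter_subset_left).image, hσ.image, image_singleton] at h3
  have hcap : (A ∪ σ '' S) ∩ P = A ∩ P ∪ σ '' S := by
    rw [union_inter_distrib_right, inter_eq_left.2 hσS]
  obtain ⟨τ, hτ, hτP⟩ := hP.density (A ∪ σ '' S) (union_subset hA (hσS.trans hP.subset))
    (mk_union_lt hP.infinite hAk (by
      rw [mk_image_equiv]; exact mk_lt_of_subset hS hDk)) (σ d) (by rw [hcap]; exact h3)
  refine ⟨τ.comp σ, (hτ.mono subset_union_left).comp hσ, fun s hs => ?_, ?_⟩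
  · exact hτ _ (.inr (mem_image_of_mem σ hs))
  · rw [image_insert_eq, image_comp_equiv, (hτ.mono subset_union_right).image]
    exact insert_subset hτP hσS

/-- The extension property for sets in place of elements. -/
theorem exists_image_subset_M [Nonempty C] (hP : LovelyCalculus L kbar kappa R M P)
    (hR : IndCalculus L kbar R) (hC : IsMonster L C kbar) {A B : Set C} (hA : A ⊆ M)
    (hAk : #A < kappa) (hBk : #B < kappa) :
    ∃ σ : C ≃[L] C, Fixes σ A ∧ σ '' B ⊆ M ∧ R (σ '' B) A P := by
  have hAs := hAk.trans hP.lt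
  have hPs := mk_lt_of_subset hP.subset hP.small
  have h0 : R ∅ A P := hR.symm (hR.mono_right (hR.base_right hPs hAs) (empty_subset A))
  refine hC.exists_equiv_of_step (Q := fun S => S ⊆ M ∧ R S A P)
    ((mk_union_lt hP.infinite hAk hBk).trans hP.lt) ⟨empty_subset _, h0⟩
    (fun _ _ hS hT => ⟨hT.trans hS.1, hR.mono_left hS.2 hT⟩) (fun S hSB hS => ⟨?_, ?_⟩) ?_
  · exact fun x hx => (hS {x} (singleton_subset_iff.2 hx) (finite_singleton x)).1 rfl
  · exact hR.of_finite ((hSB.trans_lt hBk).trans hP.lt) hAs hPs fun T hT hTf => (hS T hT hTf).2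
  intro S σ d hS hd hσ hσS
  obtain ⟨τ, hτ, hτM, hτR⟩ := hP.extension (A ∪ σ '' S) (union_subset hA hσS.1)
    (mk_union_lt hP.infinite hAk (by
      rw [mk_image_equiv]; exact mk_lt_of_subset hS hBk)) (σ d)
  refine ⟨τ.comp σ, (hτ.mono subset_union_left).comp hσ, fun s hs => ?_, ?_⟩
  · exact hτ _ (.inr (mem_image_of_mem σ hs))
  · rw [image_insert_eq, image_comp_equiv, (hτ.mono subset_union_right).image]
    refine ⟨insert_subset hτM hσS.1, hR.mono_left (hR.trans_left hσS.2 hτR) ?_⟩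
    rintro x (rfl | hx)
    · exact .inr rfl
    · exact .inl (.inr hx)

/-- Given a map `σ` between very small `P`-independent sets `X` and `σ(X)`, and a `P`-independent
extension `X'` of `X` whose image is independent over `σ(X)` from some very small subset `F` of `M`,
the image of `X'` can be moved over `F` onto a `P`-independent subset of `M`. -/
theorem exists_freeMap [Nonempty C] (hP : LovelyCalculus L kbar kappa R M P)
    (hR : IndCalculus L kbar R) (hC : IsMonster L C kbar) {X Q X' Q' F : Set C} {σ : C ≃[L] C}
    (h : FreeMap kappa R M P σ X Q) (hX' : Free kappa R M P X' Q') (hXX : X ⊆ X') (hQQ : Q ⊆ Q')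
    (hXF : σ '' X ⊆ F) (hF : F ⊆ M) (hFk : #F < kappa) (hind : R (σ '' X') (σ '' X) F) :
    ∃ ρ : C ≃[L] C, Fixes ρ F ∧ FreeMap kappa R M P (ρ.comp σ) X' Q' := by
  have hQ'k : #(σ '' Q') < kappa := by
    rw [mk_image_equiv]; exact mk_lt_of_subset hX'.base_subset hX'.small
  have hQF : σ '' Q ⊆ F ∩ P :=
    subset_inter ((image_mono h.source.base_subset).trans hXF) h.target.base_subset_P
  -- First `σ(Q')` is moved into `P`.
  have h1 : R (σ '' Q') (σ '' Q) (σ '' X) :=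
    hR.image σ (hR.symm (hR.mono_right h.source.indep hX'.base_subset_P))
  have h2 : R (σ '' Q') (σ '' X) F := hR.mono_left hind (image_mono hX'.base_subset)
  have h3 : R (σ '' Q') (F ∩ P) F :=
    hR.base_mono (hR.trans h1 h2 (image_mono h.source.base_subset) hXF) hQF inter_subset_left
  obtain ⟨ρ₁, hρ₁, hρ₁P⟩ := hP.exists_image_subset_P hR hC hF hFk hQ'k h3
  set Q₁ := ρ₁ '' (σ '' Q') with hQ₁
  have hQ₁k : #Q₁ < kappa := by rw [hQ₁, mk_image_equiv]; exact hQ'k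
  -- Then the image of `X'` is moved into `M`, independently from `P`.
  obtain ⟨ρ₂, hρ₂, hρ₂M, hρ₂R⟩ := hP.exists_image_subset_M hR hC (A := F ∪ Q₁)
    (B := ρ₁ '' (σ '' X')) (union_subset hF (hρ₁P.trans hP.subset))
    (mk_union_lt hP.infinite hFk hQ₁k) (by
      rw [mk_image_equiv, mk_image_equiv]; exact hX'.small)
  set X₂ := ρ₂ '' (ρ₁ '' (σ '' X')) with hX₂
  have hQ₂ : ρ₂ '' Q₁ = Q₁ := (hρ₂.mono subset_union_right).image
  have hQ₁X : Q₁ ⊆ X₂ := by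
    rw [← hQ₂]
    exact image_mono (image_mono (image_mono hX'.base_subset))
  have hY : σ '' X ⊆ X₂ := by
    have : ρ₂ '' (ρ₁ '' (σ '' X)) = σ '' X := by
      rw [(hρ₁.mono hXF).image, ((hρ₂.mono subset_union_left).mono hXF).image]
    rw [← this]
    exact image_mono (image_mono (image_mono hXX))
  have hQQ₁ : σ '' Q ⊆ Q₁ := by
    have : ρ₁ '' (σ '' Q) = σ '' Q := (hρ₁.mono (hQF.trans inter_subset_left)).image
    rw [← this]
    exact image_mono (image_mono hQQ)
  have h4 : R X₂ (σ '' X) F := by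
    have := hR.image ρ₂ (hR.image ρ₁ hind)
    rwa [hρ₁.image, (hρ₂.mono subset_union_left).image, (hρ₁.mono hXF).image,
      ((hρ₂.mono subset_union_left).mono hXF).image] at this
  have h5 : R X₂ (σ '' X ∪ Q₁) P := by
    refine hR.mono_right (hR.trans_right (hR.base_mono_left h4 hQ₁X) (E := P) ?_)
      subset_union_right
    have : σ '' X ∪ Q₁ ∪ F = F ∪ Q₁ := by
      ext y
      have := @hXF y
      simp only [mem_union]
      tauto
    rw [this]
    exact hρ₂R
  have h6 : R (σ '' X) Q₁ P := by
    have := hR.base_mono_right h.target.indep hρ₁P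
    rwa [union_eq_right.2 hQQ₁] at this
  have h7 : R X₂ Q₁ P :=
    hR.mono_left (hR.trans_left h6 (E := X₂) (by rwa [union_comm])) subset_union_right
  refine ⟨ρ₂.comp ρ₁, (hρ₂.mono subset_union_left).comp hρ₁, hX', ?_⟩
  have e : ∀ S : Set C, (ρ₂.comp ρ₁).comp σ '' S = ρ₂ '' (ρ₁ '' (σ '' S)) := fun S => by
    rw [image_comp_equiv, image_comp_equiv]
  rw [e, e, ← hX₂, ← hQ₁, hQ₂]
  refine ⟨hρ₂M, hQ₁X, hρ₁P, ?_, h7⟩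
  rw [hX₂, mk_image_equiv, mk_image_equiv, mk_image_equiv]
  exact hX'.small

/-- The back-and-forth property of the system of maps between very small `P`-independent sets. -/
theorem exists_freeMap_insert [Nonempty C] (hP : LovelyCalculus L kbar kappa R M P)
    (hR : IndCalculus L kbar R) (hC : IsMonster L C kbar) {X Q : Set C} {σ : C ≃[L] C}
    (h : FreeMap kappa R M P σ X Q) {m : C} (hm : m ∈ M) :
    ∃ (X' Q' : Set C) (τ : C ≃[L] C), FreeMap kappa R M P τ X' Q' ∧ X ⊆ X' ∧ m ∈ X' ∧
      ∀ x ∈ X, τ x = σ x := by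
  obtain ⟨X', Q', hX', hXX, hQQ, hmX⟩ := hP.exists_free_insert hR h.source hm
  obtain ⟨ρ, hρ, hτ⟩ := hP.exists_freeMap hR hC h hX' hXX hQQ Subset.rfl h.target.subset
    h.target.small (hR.base_right (by rw [mk_image_equiv]; exact hX'.small.trans hP.lt)
      (h.target.small.trans hP.lt))
  exact ⟨X', Q', ρ.comp σ, hτ, hXX, hmX, fun x hx => hρ _ (mem_image_of_mem σ hx)⟩

end LovelyCalculus

end Lovely

/-! ### Formulas of the language of pairs -/

section BackAndForth

variable {L : FirstOrder.Language.{u, v}} {C : Type w} [L.Structure C]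
  {M : L.ElementarySubstructure C} {P : Set M}

/-- Terms of the language of pairs commute with automorphisms of the monster model. -/
theorem coe_term_realize_pair (σ : C ≃[L] C) {ι : Type*} {f g : ι → M}
    (hfg : ∀ i, σ (f i : C) = g i) (t : (L2 L).Term ι) :
    letI := pairStructure L P
    σ ((t.realize f : M) : C) = (t.realize g : M) := by
  let := predStructure P
  let := pairStructure L P
  induction t with
  | var i => exact hfg i
  | func F ts ih =>
    rcases F with F | F
    · have h1 : ∀ x : _ → M, ((Structure.funMap (L := L) F x : M) : C) =
          Structure.funMap F fun i => (x i : C) := fun x => M.subtype.map_fun F x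
      change σ (Structure.funMap (L := L) F _ : M) = (Structure.funMap (L := L) F _ : M)
      rw [h1, h1, Equiv.map_fun]
      exact congrArg _ (funext ih)
    · exact F.elim

/-- Formulas of the language of pairs are preserved by the partial elementary maps between very
small `P`-independent sets. -/
theorem realize_pair_iff [Nonempty C] {kbar kappa : Cardinal.{w}}
    {R : Set C → Set C → Set C → Prop} (hP : LovelyCalculus L kbar kappa R (M : Set C) (up P))
    (hR : IndCalculus L kbar R) (hC : IsMonster L C kbar) {α : Type*} {n : ℕ}
    (φ : (L2 L).BoundedFormula α n) {X Q : Set C} {σ : C ≃[L] C}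
    (h : FreeMap kappa R (M : Set C) (up P) σ X Q) {v v' : α → M} {xs xs' : Fin n → M}
    (hv : ∀ i, (v i : C) ∈ X ∧ σ (v i : C) = v' i)
    (hxs : ∀ i, (xs i : C) ∈ X ∧ σ (xs i : C) = xs' i) :
    letI := pairStructure L P
    φ.Realize v xs ↔ φ.Realize v' xs' := by
  let := predStructure P
  let := pairStructure L P
  have hsum : ∀ {n : ℕ} {X : Set C} {σ : C ≃[L] C} {xs xs' : Fin n → M},
      (∀ i, (v i : C) ∈ X ∧ σ (v i : C) = v' i) →
      (∀ i, (xs i : C) ∈ X ∧ σ (xs i : C) = xs' i) →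
      ∀ i, ((Sum.elim v xs i : M) : C) ∈ X ∧ σ (Sum.elim v xs i : M) = (Sum.elim v' xs' i : M) :=
    fun hv hxs i => by rcases i with i | i <;> simp [hv, hxs]
  induction φ generalizing X Q σ with
  | falsum => rfl
  | equal t₁ t₂ =>
    have e := fun t : (L2 L).Term (α ⊕ Fin _) =>
      coe_term_realize_pair (P := P) σ (fun i => (hsum hv hxs i).2) t
    change t₁.realize _ = t₂.realize _ ↔ t₁.realize _ = t₂.realize _
    rw [← Subtype.coe_inj, ← Subtype.coe_inj, ← e t₁, ← e t₂, σ.injective.eq_iff]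
  | rel r ts =>
    rcases r with r | r
    · have e := fun t : (L2 L).Term (α ⊕ Fin _) =>
        coe_term_realize_pair (P := P) σ (fun i => (hsum hv hxs i).2) t
      have h1 : ∀ x : _ → M, Structure.RelMap (L := L) r x ↔
          Structure.RelMap r fun i => (x i : C) := fun x => (M.subtype.map_rel r x).symm
      change Structure.RelMap (L := L) (M := M) r _ ↔ Structure.RelMap (L := L) (M := M) r _
      rw [h1, h1, ← StrongHomClass.map_rel σ]
      exact iff_of_eq (congrArg _ (funext fun i => e (ts i)))
    · cases r
      change (ts 0).realize _ ∈ P ↔ (ts 0).realize _ ∈ P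
      -- The value `m` of the term need not lie in `X`: the map is extended to `m`.
      set m := (ts 0).realize (Sum.elim v xs) with hm
      obtain ⟨X', Q', τ, hτ, hXX, hmX, hτσ⟩ := hP.exists_freeMap_insert hR hC h m.2
      have e := coe_term_realize_pair (P := P) τ (f := Sum.elim v xs) (g := Sum.elim v' xs')
        (fun i => by rw [hτσ _ (hsum hv hxs i).1]; exact (hsum hv hxs i).2) (ts 0)
      have hiff := hP.mem_iff_image_mem hR hτ hmX
      rw [e] at hiff
      simpa [up] using hiff
  | imp φ ψ ihφ ihψ =>
    simp only [BoundedFormula.realize_imp]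
    exact imp_congr (ihφ h hv hxs) (ihψ h hv hxs)
  | @all n φ ih =>
    simp only [BoundedFormula.realize_all]
    have step : ∀ {X Q : Set C} {σ : C ≃[L] C},
        FreeMap kappa R (M : Set C) (up P) σ X Q → ∀ a : M,
        ∃ (X' Q' : Set C) (τ : C ≃[L] C) (b : M), FreeMap kappa R (M : Set C) (up P) τ X' Q' ∧
          X ⊆ X' ∧ (a : C) ∈ X' ∧ (∀ x ∈ X, τ x = σ x) ∧ τ (a : C) = b := by
      intro X Q σ h a
      obtain ⟨X', Q', τ, hτ, hXX, haX, hτσ⟩ := hP.exists_freeMap_insert hR hC h a.2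
      exact ⟨X', Q', τ, ⟨τ a, hτ.target.subset (mem_image_of_mem τ haX)⟩, hτ, hXX, haX, hτσ, rfl⟩
    constructor
    · intro H b
      obtain ⟨X', Q', τ, a, hτ, hXX, hbX, hτσ, hτb⟩ := step h.symm b
      have hback : ∀ {x y : M}, (x : C) ∈ X → σ (x : C) = y → (x : C) ∈ τ '' X' ∧
          τ.symm (x : C) = y := by
        intro x y hx hxy
        have hy : τ (y : C) = x := by
          rw [← hxy, hτσ _ (mem_image_of_mem σ hx)]
          simp
        exact ⟨⟨y, hXX (hxy ▸ mem_image_of_mem σ hx), hy⟩, by rw [← hy]; simp⟩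
      refine (ih hτ.symm (fun i => hback (hv i).1 (hv i).2) (fun i => ?_)).1 (H a)
      refine Fin.lastCases ?_ (fun i => ?_) i
      · simp only [Fin.snoc_last]
        exact ⟨⟨b, hbX, hτb⟩, by rw [← hτb]; simp⟩
      · simp only [Fin.snoc_castSucc]
        exact hback (hxs i).1 (hxs i).2
    · intro H a
      obtain ⟨X', Q', τ, b, hτ, hXX, haX, hτσ, hτa⟩ := step h a
      refine (ih hτ (fun i => ⟨hXX (hv i).1, (hτσ _ (hv i).1).trans (hv i).2⟩)
        (fun i => ?_)).2 (H b)
      refine Fin.lastCases ?_ (fun i => ?_) i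
      · simp only [Fin.snoc_last]
        exact ⟨haX, hτa⟩
      · simp only [Fin.snoc_castSucc]
        exact ⟨hXX (hxs i).1, (hτσ _ (hxs i).1).trans (hxs i).2⟩

end BackAndForth

/-! ### Conjugates of a tuple in a definable set of the pair -/

section Closures

variable {L : FirstOrder.Language.{u, v}} {C : Type w} [L.Structure C]
  {M : L.ElementarySubstructure C} {P : Set M} {kbar kappa : Cardinal.{w}}

theorem up_preimage {A : Set C} (hA : A ⊆ M) : up (Subtype.val ⁻¹' A : Set M) = A := by
  ext x
  constructor
  · rintro ⟨y, hy, rfl⟩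
    exact hy
  · exact fun hx => ⟨⟨x, hA hx⟩, hx, rfl⟩

theorem up_subset (A : Set M) : up A ⊆ (M : Set C) := by
  rintro _ ⟨a, -, rfl⟩
  exact a.2

theorem mk_up (A : Set M) : #(up A : Set C) = #A :=
  mk_image_eq Subtype.val_injective

theorem IsLovelyPair.lovelyCalculus [Nonempty C] {Ind : Set C → Set C → Set C → Prop}
    (hM : IsLovelyPair kbar Ind kappa M P) (hC : IsMonster L C kbar)
    (hI : IsIndependenceRelation L kbar Ind) (hκ : kappaZero kbar Ind ≤ kappa)
    (hinf : ℵ₀ ≤ kappa) (hlt : kappa < kbar) :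
    LovelyCalculus L kbar kappa
      (fun A B D => (#A < kbar ∧ #B < kbar ∧ #D < kbar) ∧ Ind A B D) (M : Set C) (up P) where
  infinite := hinf
  lt := hlt
  subset := up_subset P
  small := hM.small
  local_character A B hA hB := by
    obtain ⟨B₀, h1, h2, h3⟩ := (hI.kappaZero_spec (hinf.trans hlt.le)).2 A B hA hB
    exact ⟨B₀, h1, h2.trans_le hκ,
      ⟨mk_lt_of_finite (hinf.trans hlt.le) hA, mk_lt_of_subset h1 hB, hB⟩, h3⟩
  density A hA hAk c hc := by
    have hup := up_preimage (M := M) hA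
    have hupP : up ((Subtype.val ⁻¹' A : Set M) ∩ P) = A ∩ up P := by
      rw [up, image_inter Subtype.val_injective]
      exact congrArg (· ∩ up P) hup
    obtain ⟨b, hb, hbq⟩ := hM.density (Subtype.val ⁻¹' A) (by rwa [← mk_up, hup])
      (Theory.typeOf _ fun _ => c) ⟨c, rfl, by rw [hupP, hup]; exact hc.2⟩
    obtain ⟨σ, h1, h2⟩ := hC.exists_equiv_of_realizes (by
      rw [hup, insert_eq]
      exact mk_union_lt (hinf.trans hlt.le)
        (mk_lt_of_finite (hinf.trans hlt.le) (finite_singleton c)) (hAk.trans hlt)) rfl hbq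
    exact ⟨σ, fun a ha => h1 a (hup.symm ▸ ha), h2 ▸ mem_image_of_mem _ hb⟩
  extension A hA hAk c := by
    have hup := up_preimage (M := M) hA
    obtain ⟨b, hbq, hb⟩ := hM.extension (Subtype.val ⁻¹' A) (by rwa [← mk_up, hup])
      (Theory.typeOf _ fun _ => c)
    obtain ⟨σ, h1, h2⟩ := hC.exists_equiv_of_realizes (by
      rw [hup, insert_eq]
      exact mk_union_lt (hinf.trans hlt.le)
        (mk_lt_of_finite (hinf.trans hlt.le) (finite_singleton c)) (hAk.trans hlt)) rfl hbq
    refine ⟨σ, fun a ha => h1 a (hup.symm ▸ ha), h2 ▸ b.2, ⟨?_, hAk.trans hlt, ?_⟩, ?_⟩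
    · exact mk_lt_of_finite (hinf.trans hlt.le) (finite_singleton _)
    · exact mk_lt_of_subset (up_subset P) hM.small
    · rw [h2]
      rwa [hup] at hb

variable {R : Set C → Set C → Set C → Prop}

/-- Finitely many elements of a `P`-independent set lie in a very small `P`-independent subset. -/
theorem LovelyCalculus.exists_free_subset {M P : Set C} (hP : LovelyCalculus L kbar kappa R M P)
    (hR : IndCalculus L kbar R) {A A₀ : Set C} (hAM : A ⊆ M) (hA : R A (A ∩ P) P) (h₀ : A₀ ⊆ A)
    (hf : A₀.Finite) : ∃ X Q, Free kappa R M P X Q ∧ A₀ ⊆ X ∧ X ⊆ A := by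
  obtain ⟨B, hB, hBk, hind⟩ := hP.local_character A₀ (A ∩ P) hf (hR.small hA).2.1
  refine ⟨A₀ ∪ B, B, ⟨?_, subset_union_right, hB.trans inter_subset_right, ?_, ?_⟩,
    subset_union_left, ?_⟩
  · exact (union_subset h₀ (hB.trans inter_subset_left)).trans hAM
  · exact mk_union_lt hP.infinite (mk_lt_of_finite hP.infinite hf) hBk
  · exact hR.union_base (hR.trans hind (hR.mono_left hA h₀) hB inter_subset_right)
  · exact union_subset h₀ (hB.trans inter_subset_left)

theorem mk_iUnion_fin_lt (hk : ℵ₀ ≤ kbar) {n : ℕ} {f : Fin n → Set C} (hf : ∀ i, #(f i) < kbar) :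
    #(⋃ i, f i : Set C) < kbar := by
  induction n with
  | zero => simpa using aleph0_pos.trans_le hk
  | succ n ih =>
    have : (⋃ i, f i) = f 0 ∪ ⋃ i : Fin n, f i.succ := by
      ext x
      simp [Fin.exists_fin_succ]
    rw [this]
    exact mk_union_lt hk (hf 0) (ih fun i => hf i.succ)

/-- The formula `ε`, in two `k`-tuples of variables, is satisfied by the pair `(x, y)`. -/
def Equivalent {N : Type*} [L.Structure N] {k : ℕ} (ε : L.Formula (Fin k ⊕ Fin k))
    (x y : Fin k → N) : Prop :=
  ε.Realize (Sum.elim x y)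

theorem equivalent_equiv {k : ℕ} (ε : L.Formula (Fin k ⊕ Fin k)) (σ : C ≃[L] C)
    (x y : Fin k → C) : Equivalent ε (σ ∘ x) (σ ∘ y) ↔ Equivalent ε x y := by
  rw [Equivalent, ← Sum.comp_elim]
  exact sameTy_equiv σ _ ε

theorem equivalent_coe {k : ℕ} (ε : L.Formula (Fin k ⊕ Fin k)) (x y : Fin k → M) :
    Equivalent ε (fun i => (x i : C)) (fun i => (y i : C)) ↔ Equivalent ε x y := by
  have := sameTy_elementarySubstructure M (Sum.elim x y) ε
  rw [Equivalent, Equivalent, ← this]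
  refine iff_of_eq (congrArg _ (funext fun i => ?_))
  rcases i with i | i <;> rfl

theorem equivalent_euclidean {k : ℕ} {ε : L.Formula (Fin k ⊕ Fin k)}
    (hε : ∀ x y z : Fin k → M, Equivalent ε x z → Equivalent ε y z → Equivalent ε x y)
    {x y z : Fin k → C} (hxz : Equivalent ε x z) (hyz : Equivalent ε y z) : Equivalent ε x y := by
  let ψ : L.Formula (Empty ⊕ (Fin 3 × Fin k)) :=
    (ε.relabel (Sum.elim (fun i => .inr (0, i)) fun i => .inr (2, i))).imp
      ((ε.relabel (Sum.elim (fun i => .inr (1, i)) fun i => .inr (2, i))).imp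
        (ε.relabel (Sum.elim (fun i => .inr (0, i)) fun i => .inr (1, i))))
  have e : ∀ {N : Type w} [L.Structure N] (a : Empty → N) (u : Fin 3 × Fin k → N),
      ψ.Realize (Sum.elim a u) ↔
        (Equivalent ε (fun i => u (0, i)) (fun i => u (2, i)) →
          Equivalent ε (fun i => u (1, i)) (fun i => u (2, i)) →
          Equivalent ε (fun i => u (0, i)) (fun i => u (1, i))) := by
    intro N _ a u
    simp only [ψ, Formula.realize_imp, Formula.realize_relabel, Equivalent, Sum.comp_elim]
    rfl
  have h := (forall_realize_iff M ψ (fun a => a.elim)).2 (fun u => (e _ u).2 (hε _ _ _))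
    (fun p : Fin 3 × Fin k => ![x, y, z] p.1 p.2)
  exact (e _ _).1 h hxz hyz

/-- Let `D` be a set of tuples of `M` that is preserved by the partial elementary maps between very
small `P`-independent sets that fix `X`, and let `D` be covered by the classes of `n` tuples. Then
no element of `D` has `n + 1` inequivalent conjugates over `X` in the monster model: some copy of
those conjugates is independent over `X` from the `n` given tuples, one of the copies is
inequivalent to each of them, and it can be realized in `M` by means of `exists_freeMap`. -/
theorem LovelyCalculus.exists_equivalent_conjugates [Nonempty C]
    (hP : LovelyCalculus L kbar kappa R (M : Set C) (up P)) (hR : IndCalculus L kbar R)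
    (hC : IsMonster L C kbar) {X Q : Set C} (hX : Free kappa R (M : Set C) (up P) X Q)
    {k n : ℕ} {ε : L.Formula (Fin k ⊕ Fin k)}
    (hε : ∀ x y z : Fin k → M, Equivalent ε x z → Equivalent ε y z → Equivalent ε x y)
    {D : Set (Fin k → M)} {c : Fin k → M} (r : Fin n → Fin k → M)
    (hr : ∀ x ∈ D, ∃ i, Equivalent ε x (r i))
    (hinv : ∀ (X' Q' : Set C) (σ : C ≃[L] C) (c' : Fin k → M),
      FreeMap kappa R (M : Set C) (up P) σ X' Q' → Fixes σ X → X ⊆ X' →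
      (∀ i, (c i : C) ∈ X' ∧ σ (c i : C) = c' i) → c' ∈ D)
    (d : Fin (n + 1) → Fin k → C) (hd : ∀ j, SameTypeOver L X (d j) fun i => (c i : C)) :
    ∃ i j, i ≠ j ∧ Equivalent ε (d i) (d j) := by
  have hXs := hX.small.trans hP.lt
  obtain ⟨B, Q', hB, hXB, hQQ, hcB⟩ := hP.exists_free_union hR hX
    (finite_range fun i => (c i : C)) (by rintro _ ⟨i, rfl⟩; exact (c i).2)
  have hcB' : ∀ i, (c i : C) ∈ B := fun i => hcB (mem_range_self i)
  choose σ hσ hσd using fun j => hC.exists_equiv_over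
    (mk_union_lt hR.infinite hXs (mk_lt_of_finite hR.infinite (finite_range _))) (hd j)
  let F : Set C := X ∪ range fun p : Fin n × Fin k => (r p.1 p.2 : C)
  have hFk : #F < kappa :=
    mk_union_lt hP.infinite hX.small (mk_lt_of_finite hP.infinite (finite_range _))
  have hFM : F ⊆ M := union_subset hX.subset (by rintro _ ⟨p, rfl⟩; exact (r _ _).2)
  obtain ⟨τ, hτ, hind⟩ := hR.extension (A := ⋃ j, σ j '' B) (B := X) (D := F)
    (mk_iUnion_fin_lt hR.infinite fun j => by
      rw [mk_image_equiv]; exact hB.small.trans hP.lt) hXs (hFk.trans hP.lt)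
  by_contra! hne
  -- There are `n + 1` inequivalent copies, and each of the `n` tuples is equivalent to at most one.
  obtain ⟨j, hj⟩ : ∃ j, ∀ i, ¬ Equivalent ε (τ ∘ d j) fun l => (r i l : C) := by
    by_contra! h
    choose i hi using h
    obtain ⟨j, j', hjj, hij⟩ := Fintype.exists_ne_map_eq_of_card_lt i (by simp)
    refine hne j j' hjj ((equivalent_equiv ε τ _ _).1 ?_)
    exact equivalent_euclidean hε (hi j) (hij ▸ hi j')
  have hfix : Fixes (τ.comp (σ j)) X := hτ.comp (hσ j)
  have hmap : FreeMap kappa R (M : Set C) (up P) (τ.comp (σ j)) X Q :=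
    ⟨hX, by rwa [hfix.image, (hfix.mono hX.base_subset).image]⟩
  obtain ⟨ρ, hρ, hρm⟩ := hP.exists_freeMap hR hC hmap hB hXB hQQ (F := F)
    (by rw [hfix.image]; exact subset_union_left) hFM hFk (by
      rw [hfix.image, image_comp_equiv]
      exact hR.mono_left hind (image_mono (subset_iUnion (fun j => σ j '' B) j)))
  have hρτ : ∀ i, ρ.comp (τ.comp (σ j)) (c i : C) = ρ (τ (d j i)) := fun i => by
    rw [Equiv.comp_apply, Equiv.comp_apply, hσd]
  let c' : Fin k → M := fun i => ⟨ρ (τ (d j i)), by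
    rw [← hρτ]
    exact hρm.target.subset (mem_image_of_mem _ (hcB' i))⟩
  obtain ⟨i, hi⟩ := hr c' (hinv B Q' _ c' hρm ((hρ.mono subset_union_left).comp hfix) hXB
    fun i => ⟨hcB' i, hρτ i⟩)
  refine hj i ((equivalent_equiv ε ρ _ _).1 ?_)
  have hri : (ρ ∘ fun l => (r i l : C)) = fun l => (r i l : C) :=
    funext fun l => hρ _ (.inr ⟨(i, l), rfl⟩)
  rw [hri]
  exact (equivalent_coe ε _ _).2 hi

end Closures

/-! ### Imaginaries -/

section Imaginaries

variable {L : FirstOrder.Language.{u, v}} {C : Type w} [L.Structure C] [Nonempty C]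
  {M : L.ElementarySubstructure C} {P : Set M} {kbar kappa : Cardinal.{w}}
  {R : Set C → Set C → Set C → Prop}

/-- The set of classes of the realizations of a formula with parameters in `A` is definable
over `A`. -/
theorem EqSort.definableOver_classes {N : Type*} [L.Structure N] (S : EqSort L N) {A X : Set N}
    (hXA : X ⊆ A) (φ : L.Formula (X ⊕ Fin S.arity)) :
    S.DefinableOver A
      (Quotient.mk S.rel '' {x | φ.Realize (Sum.elim (Subtype.val : X → N) x)}) := by
  obtain ⟨ε, hε⟩ := empty_definable_iff.1 S.definable
  refine definable_iff_exists_formula_sum.2 ⟨((φ.relabel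
    (Sum.elim (fun a => .inl (.inl (inclusion hXA a))) .inr :
      X ⊕ Fin S.arity → (A ⊕ Fin S.arity) ⊕ Fin S.arity)) ⊓
    (ε.relabel (Sum.elim .inr fun i => .inl (.inr i) :
      Fin S.arity ⊕ Fin S.arity → (A ⊕ Fin S.arity) ⊕ Fin S.arity))).iExs (Fin S.arity), ?_⟩
  ext x
  have hr : ∀ y : Fin S.arity → N, S.rel y x ↔ ε.Realize (Sum.elim y x) := fun y =>
    Set.ext_iff.1 hε (Sum.elim y x)
  simp only [mem_ofPred_eq, Formula.realize_iExs, Formula.realize_inf, Formula.realize_relabel,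
    Sum.comp_elim]
  constructor
  · rintro ⟨y, hy, hyx⟩
    exact ⟨y, hy, (hr y).1 (Quotient.exact hyx)⟩
  · rintro ⟨y, hy, hyx⟩
    exact ⟨y, hy, Quotient.sound ((hr y).2 hyx)⟩

/-- An imaginary in a finite set which is definable over a `P`-independent set `A` in the language
of pairs lies in a set of at most the same size which is definable over `A` in the original
language. -/
theorem LovelyCalculus.exists_definableOver_encard_le
    (hP : LovelyCalculus L kbar kappa R (M : Set C) (up P)) (hR : IndCalculus L kbar R)
    (hC : IsMonster L C kbar) {A : Set M} (hA : R (up A) (up (A ∩ P)) (up P))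
    (S : EqSort L M) {e : Quotient S.rel} {D : Set (Quotient S.rel)} (hD : D.Finite) (he : e ∈ D)
    (hdef : letI := pairStructure L P
      A.Definable (L2 L) {x : Fin S.arity → M | Quotient.mk S.rel x ∈ D}) :
    ∃ D' : Set (Quotient S.rel), e ∈ D' ∧ S.DefinableOver A D' ∧ D'.encard ≤ D.encard := by
  let := pairStructure L P
  obtain ⟨ε, hε⟩ := empty_definable_iff.1 S.definable
  have hr : ∀ x y : Fin S.arity → M, S.rel x y ↔ Equivalent ε x y := fun x y =>
    Set.ext_iff.1 hε (Sum.elim x y)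
  obtain ⟨c, rfl⟩ := Quotient.exists_rep e
  obtain ⟨A₀, hA₀, hdef₀⟩ := definable_iff_finitely_definable.1 hdef
  obtain ⟨φ₂, hφ₂⟩ := definable_iff_exists_formula_sum.1 hdef₀
  have hup : up (A ∩ P) = up A ∩ up P := image_inter Subtype.val_injective
  obtain ⟨X, Q, hX, hA₀X, hXA⟩ := hP.exists_free_subset hR (A₀ := up (A₀ : Set M)) (up_subset A)
    (hup ▸ hA) (image_mono hA₀) (A₀.finite_toSet.image _)
  -- The set `X`, as a subset of `M`.
  let X' : Set M := Subtype.val ⁻¹' X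
  have hX' : X' ⊆ A := fun x hx => by
    obtain ⟨a, ha, hax⟩ := hXA hx
    exact Subtype.coe_injective hax ▸ ha
  by_contra! hcon
  have : Finite D := hD
  let n := Nat.card D
  let r : Fin n → Fin S.arity → M := fun i => ((Finite.equivFin D).symm i).1.out
  -- The formula `θ` says that `n + 1` tuples are pairwise inequivalent.
  let θ : L.Formula (Fin (n + 1) × Fin S.arity) :=
    Formula.iInf fun p : {p : Fin (n + 1) × Fin (n + 1) // p.1 ≠ p.2} =>
      (ε.relabel (Sum.elim (fun i => (p.1.1, i)) fun i => (p.1.2, i))).not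
  have hθ : ∀ d : Fin (n + 1) → Fin S.arity → C, (θ.Realize fun p => d p.1 p.2) ↔
      ∀ i j, i ≠ j → ¬ Equivalent ε (d i) (d j) := by
    intro d
    simp only [θ, Formula.realize_iInf, Formula.realize_not, Formula.realize_relabel,
      Sum.comp_elim, Subtype.forall, Prod.forall]
    rfl
  obtain ⟨d, hd, hdθ⟩ := hC.exists_conjugates hR.infinite (hX.small.trans hP.lt)
    (fun i => (c i : C)) θ (by
      intro φ hφ
      let f : X → X' := fun x => ⟨⟨x, hX.subset x.2⟩, x.2⟩
      let φ' : L.Formula (X' ⊕ Fin S.arity) := φ.relabel (Sum.map f id)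
      have hφ' : ∀ x : Fin S.arity → M, φ'.Realize (Sum.elim (Subtype.val : X' → M) x) ↔
          φ.Realize (Sum.elim (Subtype.val : X → C) fun i => (x i : C)) := by
        intro x
        rw [Formula.realize_relabel, ← sameTy_elementarySubstructure M _ φ]
        refine iff_of_eq (congrArg _ (funext fun i => ?_))
        rcases i with i | i <;> rfl
      have hlt := hcon _ (mem_image_of_mem _ ((hφ' c).2 hφ)) (S.definableOver_classes hX' φ')
      obtain ⟨T, hT, hTn⟩ := exists_subset_encard_eq (k := ((n + 1 : ℕ) : ℕ∞)) (by
        rw [← hD.cast_ncard_eq] at hlt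
        exact_mod_cast Order.add_one_le_of_lt hlt)
      have hTfin : T.Finite := finite_of_encard_eq_coe hTn
      have : Finite T := hTfin
      have hTc : Nat.card T = n + 1 := by
        have := hTfin.cast_ncard_eq.trans hTn
        exact_mod_cast this
      let g := Finite.equivFinOfCardEq hTc
      choose t ht htq using fun i : Fin (n + 1) => hT (g.symm i).2
      refine ⟨fun j i => t j i, fun j => (hφ' _).1 (ht j), (hθ fun j i => (t j i : C)).2 fun i j hij heq => ?_⟩
      rw [equivalent_coe, ← hr] at heq
      refine hij (g.symm.injective (Subtype.coe_injective ?_))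
      exact (htq i).symm.trans ((Quotient.sound heq).trans (htq j)))
  obtain ⟨i, j, hij, heq⟩ := hP.exists_equivalent_conjugates hR hC hX (ε := ε)
    (fun x y z hxz hyz => by
      rw [← hr] at hxz hyz ⊢
      exact S.rel.trans hxz (S.rel.symm hyz))
    (D := {x | Quotient.mk S.rel x ∈ D}) r
    (fun x hx => ⟨Finite.equivFin D ⟨_, hx⟩, by
      rw [← hr]
      refine Quotient.exact ?_
      rw [Quotient.out_eq]
      exact congrArg Subtype.val ((Finite.equivFin D).symm_apply_apply ⟨_, hx⟩).symm⟩)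
    (fun X₁ Q₁ σ c' hσ hfix hXX₁ hc => by
      have h1 : φ₂.Realize (Sum.elim (fun a : (A₀ : Set M) => a.1) c) := by
        have := Set.ext_iff.1 hφ₂ c
        exact this.1 he
      have h2 : φ₂.Realize (Sum.elim (fun a : (A₀ : Set M) => a.1) c') := by
        refine (realize_pair_iff hP hR hC φ₂ hσ (fun i => ?_) fun i => i.elim0).1 h1
        rcases i with a | i
        · have haX : (a.1 : C) ∈ X := hA₀X (mem_image_of_mem _ a.2)
          exact ⟨hXX₁ haX, hfix _ haX⟩
        · exact hc i
      exact (Set.ext_iff.1 hφ₂ c').2 h2) d hd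
  exact (hθ d).1 hdθ i j hij heq

end Imaginaries

end LovelyPairs

theorem mainTheorem12 {L : FirstOrder.Language.{u, v}} {C : Type w} [L.Structure C] [Nonempty C]
    (kbar : Cardinal.{w}) (hC : LovelyPairs.IsMonster L C kbar)
    (Ind : Set C → Set C → Set C → Prop)
    (hInd : LovelyPairs.IsIndependenceRelation L kbar Ind)
    (kappa : Cardinal.{w}) (hsmall : kappa < kbar)
    (hkappa : LovelyPairs.kappaZero kbar Ind < kappa)
    (hcard : Cardinal.lift.{w} (max Cardinal.aleph0 L.card) < Cardinal.lift.{max u v} kappa)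
    (M : L.ElementarySubstructure C) (P : Set M)
    (hM : LovelyPairs.IsLovelyPair kbar Ind kappa M P)
    (A : Set M) (hA : LovelyPairs.PIndependent Ind P A) :
    LovelyPairs.acl2 L P A ∩ Set.range (LovelyPairs.inclEq P) =
        LovelyPairs.inclEq P '' LovelyPairs.aclEq L A ∧
      LovelyPairs.dcl2 L P A ∩ Set.range (LovelyPairs.inclEq P) =
        LovelyPairs.inclEq P '' LovelyPairs.dclEq L A := by
  have hinf : ℵ₀ ≤ kappa := by
    have := ((Cardinal.lift_le.{w}).2 (le_max_left ℵ₀ L.card)).trans hcard.le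
    simpa using this
  have hR := hInd.indCalculus hC (hinf.trans hsmall.le)
  have hP := hM.lovelyCalculus hC hInd hkappa.le hinf hsmall
  have hup : ∀ B : Set M, #(LovelyPairs.up B : Set C) < kbar := fun B =>
    LovelyPairs.mk_lt_of_subset (LovelyPairs.up_subset B) hM.small
  have key := fun (e : LovelyPairs.Meq L M) (D : Set (Quotient e.1.rel)) =>
    hP.exists_definableOver_encard_le hR hC ⟨⟨hup A, hup (A ∩ P), hup P⟩, hA⟩ e.1
      (e := e.2) (D := D)
  have hexp : ∀ (S : LovelyPairs.EqSort L M) (D : Set (Quotient S.rel)), S.DefinableOver A D →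
      letI := LovelyPairs.pairStructure L P
      A.Definable (LovelyPairs.L2 L) {x : Fin S.arity → M | Quotient.mk S.rel x ∈ D} := by
    intro S D h
    let := LovelyPairs.predStructure P
    let := LovelyPairs.pairStructure L P
    have : (FirstOrder.Language.LHom.sumInl : L →ᴸ LovelyPairs.L2 L).IsExpansionOn M :=
      FirstOrder.Language.LHom.sumInl_isExpansionOn M
    exact Set.Definable.map_expansion h FirstOrder.Language.LHom.sumInl
  constructor
  · ext x
    constructor
    · rintro ⟨⟨D, hD, he, hdef⟩, e, rfl⟩
      obtain ⟨D', he', hdef', hle⟩ := key e D hD he hdef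
      exact ⟨e, ⟨D', Set.finite_of_encard_le_coe (hle.trans hD.cast_ncard_eq.symm.le), he', hdef'⟩,
        rfl⟩
    · rintro ⟨e, ⟨D, hD, he, hdef⟩, rfl⟩
      exact ⟨⟨D, hD, he, hexp e.1 D hdef⟩, e, rfl⟩
  · ext x
    constructor
    · rintro ⟨hdef, e, rfl⟩
      obtain ⟨D', he', hdef', hle⟩ := key e {e.2} (Set.finite_singleton e.2) rfl hdef
      have : D' = {e.2} := by
        rw [Set.encard_singleton, Set.encard_le_one_iff] at hle
        exact Set.eq_singleton_iff_unique_mem.2 ⟨he', fun y hy => hle y e.2 hy he'⟩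
      subst this
      exact ⟨e, hdef', rfl⟩
    · rintro ⟨e, hdef, rfl⟩
      exact ⟨hexp e.1 {e.2} hdef, e, rfl⟩
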